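/- Let $k$ be a field, let $Q$ be a finite quiver with vertex set $Q_0$, and let $B=kQ/I$ be a bound quiver algebra: $I$ is a two-sided ideal of the path algebra $kQ$ with $\langle Q_n\rangle\subseteq I\subseteq\langle Q_2\rangle$ for some $n\ge 2$, where $\langle Q_n\rangle$ is the two-sided ideal generated by the paths of length $n$. Paths are composed from right to left, so that $yBx$ (for $x,y\in Q_0$) is spanned by the classes of the paths from $x$ to $y$. Modules are left modules, and for $x\in Q_0$ we denote by $P_x$ and $I_x$ the projective cover and the injective envelope of the simple $B$-module at $x$. Let $ZA$ denote the center of an algebra $A$, and $\mathsf{HH}^1(A)$ its first Hochschild cohomology with coefficients in $A$. Let $e,f\in Q_0$, let $Q_{\{a\}}$ be the quiver obtained from $Q$ by adding a single new arrow $a$ from $e$ to $f$, and let $B_{\{a\}}=kQ_{\{a\}}/\langle I\rangle_{kQ_{\{a\}}}$, where $\langle I\rangle_{kQ_{\{a\}}}$ is the two-sided ideal of $kQ_{\{a\}}$ generated by $I$. Assume that $a$ is not a relative loop, that is, $eBf=0$. Then $B$, $B_{\{a\}}$, $\mathsf{Ext}^1_B(I_e,P_f)$ and $\mathsf{Hom}_B(I_e,P_f)$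 are finite dimensional over $k$, and \begin{align*} \dim_k\mathsf{HH}^1(B_{\{a\}})-\dim_k\mathsf{HH}^1(B)=\ &\dim_k ZB_{\{a\}}-\dim_k ZB+\dim_k fBe+\dim_k fBf\,\dim_k eBe\\ &+\dim_k\mathsf{Ext}^1_B(I_e,P_f)-\dim_k\mathsf{Hom}_B(I_e,P_f). \end{align*} -/

import Mathlib

universe u v w z

open CategoryTheory

noncomputable section

namespace QuiverHH

/-! ### Path algebras -/

section PathAlgebra

variable (k : Type u) (V : Type v) [Quiver.{w} V]

/-- All paths of the quiver `V`, with their source and target. -/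
abbrev AllPaths : Type (max v w) := Σ x y : V, Quiver.Path x y

/-- The path algebra `kQ`: the vector space whose basis is the set of all paths
(the vertices are the paths of length `0`). -/
def PathAlgebra [Semiring k] : Type (max u v w) := AllPaths V →₀ k

variable [Field k]

instance : AddCommGroup (PathAlgebra k V) := inferInstanceAs (AddCommGroup (AllPaths V →₀ k))

instance : Module k (PathAlgebra k V) := inferInstanceAs (Module k (AllPaths V →₀ k))

/-- The basis of `kQ` consisting of all paths. -/
def pathBasis : Module.Basis (AllPaths V) k (PathAlgebra k V) :=
  Module.Basis.ofRepr (LinearEquiv.refl k (AllPaths V →₀ k) : PathAlgebra k V ≃ₗ[k] _)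

variable {V}

/-- The basis element given by a path. -/
def ofPath {x y : V} (p : Quiver.Path x y) : PathAlgebra k V := pathBasis k V ⟨x, y, p⟩

open Classical in
/-- The product `β α` of two paths: first `α`, then `β` if the target of `α` is the source
of `β`, and `0` otherwise. -/
def pathMul (β α : AllPaths V) : PathAlgebra k V :=
  if h : α.2.1 = β.1 then ofPath k (α.2.2.comp (β.2.2.cast h.symm rfl)) else 0

/-- The bilinear extension of the product of paths. -/
def mulLin : PathAlgebra k V →ₗ[k] PathAlgebra k V →ₗ[k] PathAlgebra k V :=
  (pathBasis k V).constr k (fun β => (pathBasis k V).constr k (fun α => pathMul k β α))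

instance : Mul (PathAlgebra k V) := ⟨fun b a => mulLin k b a⟩

/-- The vertex `x`, as an element of the path algebra. -/
def ofVertex (x : V) : PathAlgebra k V := ofPath k (Quiver.Path.nil : Quiver.Path x x)

instance [Fintype V] : One (PathAlgebra k V) := ⟨∑ x : V, ofVertex k x⟩

variable {k}

theorem mul_def (b a : PathAlgebra k V) : b * a = mulLin k b a := rfl

theorem one_def [Fintype V] : (1 : PathAlgebra k V) = ∑ x : V, ofVertex k x := rfl

theorem mulLin_ofPath {x y y' z : V} (β : Quiver.Path y' z) (α : Quiver.Path x y) :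
    mulLin k (ofPath k β) (ofPath k α) = pathMul k ⟨y', z, β⟩ ⟨x, y, α⟩ := by
  rw [mulLin, ofPath, ofPath, Module.Basis.constr_basis, Module.Basis.constr_basis]

theorem ofPath_mul_ofPath {x y z : V} (β : Quiver.Path y z) (α : Quiver.Path x y) :
    ofPath k β * ofPath k α = ofPath k (α.comp β) := by
  rw [mul_def, mulLin_ofPath]
  simp [pathMul]

theorem ofPath_mul_ofPath_of_ne {x y y' z : V} (h : y ≠ y') (β : Quiver.Path y' z)
    (α : Quiver.Path x y) : ofPath k β * ofPath k α = 0 := by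
  rw [mul_def, mulLin_ofPath]
  simp [pathMul, h]

/-- Induction on the basis of paths. -/
theorem path_induction {P : PathAlgebra k V → Prop} (a : PathAlgebra k V) (h0 : P 0)
    (hadd : ∀ a b, P a → P b → P (a + b))
    (hpath : ∀ (c : k) {x y : V} (p : Quiver.Path x y), P (c • ofPath k p)) : P a := by
  rw [← (pathBasis k V).linearCombination_repr a]
  induction (pathBasis k V).repr a using Finsupp.induction_linear with
  | zero => simpa using h0
  | add f g hf hg => simpa using hadd _ _ hf hg
  | single p c => simpa [ofPath] using hpath c p.2.2

theorem add_mul' (a b c : PathAlgebra k V) : (a + b) * c = a * c + b * c := by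
  simp [mul_def]

theorem mul_add' (a b c : PathAlgebra k V) : a * (b + c) = a * b + a * c := by
  simp [mul_def]

theorem smul_mul' (r : k) (a b : PathAlgebra k V) : (r • a) * b = r • (a * b) := by
  simp [mul_def]

theorem mul_smul' (r : k) (a b : PathAlgebra k V) : a * (r • b) = r • (a * b) := by
  simp [mul_def]

theorem zero_mul' (a : PathAlgebra k V) : 0 * a = 0 := by simp [mul_def]

theorem mul_zero' (a : PathAlgebra k V) : a * 0 = 0 := by simp [mul_def]

theorem mul_assoc' (a b c : PathAlgebra k V) : a * b * c = a * (b * c) := by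
  induction a using path_induction with
  | h0 => simp [zero_mul']
  | hadd a a' h h' => simp [add_mul', h, h']
  | hpath r p =>
    simp only [smul_mul']
    congr 1
    induction b using path_induction with
    | h0 => simp [zero_mul', mul_zero']
    | hadd a a' h h' => simp [add_mul', mul_add', h, h']
    | hpath r' q =>
      simp only [smul_mul', mul_smul']
      congr 1
      induction c using path_induction with
      | h0 => simp [mul_zero']
      | hadd a a' h h' => simp [mul_add', h, h']
      | hpath r'' s =>
        simp only [mul_smul']
        congr 1
        rename_i x y x' y' x'' y''
        by_cases h1 : y' = x
        · subst h1
          by_cases h2 : y'' = x'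
          · subst h2
            simp [ofPath_mul_ofPath]
          · simp [ofPath_mul_ofPath, ofPath_mul_ofPath_of_ne h2, mul_zero']
        · by_cases h2 : y'' = x'
          · subst h2
            simp [ofPath_mul_ofPath, ofPath_mul_ofPath_of_ne h1, zero_mul']
          · simp [ofPath_mul_ofPath_of_ne h1, ofPath_mul_ofPath_of_ne h2, zero_mul', mul_zero']

theorem one_mul' [Fintype V] (a : PathAlgebra k V) : 1 * a = a := by
  induction a using path_induction with
  | h0 => exact mul_zero' _
  | hadd a b h h' => rw [mul_add', h, h']
  | hpath c p =>
    rename_i x y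
    rw [mul_smul']
    congr 1
    rw [one_def, mul_def, map_sum, LinearMap.sum_apply, Finset.sum_eq_single y]
    · rw [← mul_def, ofVertex, ofPath_mul_ofPath, Quiver.Path.comp_nil]
    · intro b _ hb
      rw [← mul_def, ofVertex, ofPath_mul_ofPath_of_ne hb.symm]
    · simp

theorem mul_one' [Fintype V] (a : PathAlgebra k V) : a * 1 = a := by
  induction a using path_induction with
  | h0 => exact zero_mul' _
  | hadd a b h h' => rw [add_mul', h, h']
  | hpath c p =>
    rename_i x y
    rw [smul_mul']
    congr 1
    rw [one_def, mul_def, map_sum, Finset.sum_eq_single x]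
    · rw [← mul_def, ofVertex, ofPath_mul_ofPath, Quiver.Path.nil_comp]
    · intro b _ hb
      rw [← mul_def, ofVertex, ofPath_mul_ofPath_of_ne hb]
    · simp

instance [Fintype V] : Ring (PathAlgebra k V) :=
  { (inferInstance : AddCommGroup (PathAlgebra k V)) with
    mul := (· * ·)
    one := 1
    left_distrib := mul_add'
    right_distrib := add_mul'
    zero_mul := zero_mul'
    mul_zero := mul_zero'
    mul_assoc := mul_assoc'
    one_mul := one_mul'
    mul_one := mul_one' }

instance [Fintype V] : Algebra k (PathAlgebra k V) :=
  Algebra.ofModule smul_mul' (fun r a b => mul_smul' r a b)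

/-! ### Bound quiver algebras -/

variable [Fintype V]

variable (k V) in
/-- The two-sided ideal `⟨Q_n⟩` of `kQ` generated by the paths of length `n`. -/
def pathIdeal (n : ℕ) : TwoSidedIdeal (PathAlgebra k V) :=
  TwoSidedIdeal.span {a | ∃ (x y : V) (p : Quiver.Path x y), p.length = n ∧ a = ofPath k p}

/-- A two-sided ideal `I` of `kQ` is admissible if `⟨Q_n⟩ ⊆ I ⊆ ⟨Q_2⟩` for some `n ≥ 2`. -/
def IsAdmissible (I : TwoSidedIdeal (PathAlgebra k V)) : Prop :=
  ∃ n : ℕ, 2 ≤ n ∧ pathIdeal k V n ≤ I ∧ I ≤ pathIdeal k V 2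

/-- The algebra `kQ / I`. -/
abbrev QuotAlg (I : TwoSidedIdeal (PathAlgebra k V)) : Type (max u v w) := I.ringCon.Quotient

/-- The idempotent of `kQ / I` given by the vertex `x`. -/
def idem (I : TwoSidedIdeal (PathAlgebra k V)) (x : V) : QuotAlg I := I.ringCon.mk' (ofVertex k x)

/-- The class in `kQ / I` of an arrow. -/
def arrow (I : TwoSidedIdeal (PathAlgebra k V)) {x y : V} (a : x ⟶ y) : QuotAlg I :=
  I.ringCon.mk' (ofPath k a.toPath)

/-- The subspace `yBx` of `B = kQ / I`, for vertices `y` and `x`. -/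
def corner (I : TwoSidedIdeal (PathAlgebra k V)) (y x : V) : Submodule k (QuotAlg I) :=
  LinearMap.range (LinearMap.mulLeft k (idem I y) ∘ₗ LinearMap.mulRight k (idem I x))

/-- A new arrow from `e` to `f` is a relative loop if `eBf ≠ 0`. -/
def IsRelativeLoop (I : TwoSidedIdeal (PathAlgebra k V)) (e f : V) : Prop := corner I e f ≠ ⊥

/-- The left ideal of `B = kQ / I` generated by the arrows and by the vertices other than `x`. -/
def simpleIdeal (I : TwoSidedIdeal (PathAlgebra k V)) (x : V) :
    Submodule (QuotAlg I) (QuotAlg I) :=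
  Submodule.span (QuotAlg I)
    ({b | ∃ y : V, y ≠ x ∧ b = idem I y} ∪ {b | ∃ (y z : V) (a : y ⟶ z), b = arrow I a})

/-- The simple left `B`-module at the vertex `x`: for `I` admissible it is one-dimensional,
spanned by the class of `x`, and all arrows and all other vertices act on it by zero. -/
abbrev SimpleAt (I : TwoSidedIdeal (PathAlgebra k V)) (x : V) : Type (max u v w) :=
  QuotAlg I ⧸ simpleIdeal I x

end PathAlgebra

/-! ### Adding new arrows to a quiver -/

section AddArrows

variable {V : Type v} {F : Type z}

/-- The vertices of the quiver `Q_F` obtained from `Q` by adding the set `F` of new arrows, with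
source and target maps `s` and `t`: they are those of `Q`. -/
def AddArrows (_s _t : F → V) : Type v := V

variable (s t : F → V)

instance [Fintype V] : Fintype (AddArrows s t) := inferInstanceAs (Fintype V)

/-- The arrows of `Q_F` are the arrows of `Q` together with the elements of `F`. -/
instance [Quiver.{w} V] : Quiver.{max w z} (AddArrows s t) where
  Hom x y := (Quiver.Hom (V := V) x y) ⊕ {a : F // s a = x ∧ t a = y}

/-- The inclusion of `Q` in `Q_F`. -/
def AddArrows.incl [Quiver.{w} V] : V ⥤q AddArrows s t where
  obj x := x
  map a := Sum.inl a

variable [Quiver.{w} V] [Fintype V] {k : Type u} [Field k]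

/-- The inclusion `kQ → kQ_F` of path algebras, given on paths by the inclusion of `Q` in `Q_F`. -/
def inclAlg : PathAlgebra k V →ₗ[k] PathAlgebra k (AddArrows s t) :=
  (pathBasis k V).constr k (fun p => ofPath k ((AddArrows.incl s t).mapPath p.2.2))

/-- The two-sided ideal of `kQ_F` generated by `I`. -/
def extIdeal (I : TwoSidedIdeal (PathAlgebra k V)) :
    TwoSidedIdeal (PathAlgebra k (AddArrows s t)) :=
  TwoSidedIdeal.span (inclAlg s t '' (I : Set (PathAlgebra k V)))

/-- The algebra `B_F = kQ_F / ⟨I⟩`, for `B = kQ / I`. -/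
abbrev AddArrowsAlg (I : TwoSidedIdeal (PathAlgebra k V)) : Type (max u v w z) :=
  QuotAlg (extIdeal s t I)

end AddArrows

/-! ### First Hochschild cohomology -/

section Hochschild

/-- The quotient `Z / (Z ∩ C)`, for subspaces `C` and `Z` of a vector space. -/
abbrev Subquotient {k : Type u} {M : Type v} [Field k] [AddCommGroup M] [Module k M]
    (Z C : Submodule k M) : Type v := Z ⧸ C.submoduleOf Z

variable (k : Type u) (A : Type v) [Field k] [Ring A] [Algebra k A]

/-- The Hochschild coboundary in degree `0`, `x ↦ (a ↦ a x - x a)`. Its image is the space of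
inner derivations. -/
def hochschildD0 : A →ₗ[k] (A →ₗ[k] A) := (LinearMap.mul k A).flip - LinearMap.mul k A

/-- The Hochschild coboundary in degree `1`, `φ ↦ ((a, b) ↦ a φ(b) - φ(ab) + φ(a) b)`. Its kernel
is the space of `k`-derivations of `A`. -/
def hochschildD1 : (A →ₗ[k] A) →ₗ[k] (A →ₗ[k] A →ₗ[k] A) where
  toFun φ := LinearMap.mk₂ k (fun a b => a * φ b - φ (a * b) + φ a * b)
    (fun a a' b => by simp only [add_mul, map_add]; abel)
    (fun c a b => by simp only [smul_mul_assoc, map_smul, smul_add, smul_sub])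
    (fun a b b' => by simp only [mul_add, map_add]; abel)
    (fun c a b => by simp only [mul_smul_comm, map_smul, smul_add, smul_sub])
  map_add' φ ψ := by
    ext a b
    simp only [LinearMap.mk₂_apply, LinearMap.add_apply, mul_add, add_mul]
    abel
  map_smul' c φ := by
    ext a b
    simp [smul_add, smul_sub]

/-- The space of Hochschild `1`-cocycles of `A`, that is the space of derivations of `A`. -/
def cocycles1 : Submodule k (A →ₗ[k] A) := LinearMap.ker (hochschildD1 k A)

/-- The space of Hochschild `1`-coboundaries of `A`, that is the space of inner derivations. -/
def coboundaries1 : Submodule k (A →ₗ[k] A) := LinearMap.range (hochschildD0 k A)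

/-- The first Hochschild cohomology `HH¹(A)` of a `k`-algebra `A`, with coefficients in `A`:
cocycles modulo coboundaries. -/
abbrev HH1 : Type v := Subquotient (cocycles1 k A) (coboundaries1 k A)

theorem mem_cocycles1 (φ : A →ₗ[k] A) :
    φ ∈ cocycles1 k A ↔ ∀ a b : A, φ (a * b) = a * φ b + φ a * b := by
  simp only [cocycles1, LinearMap.mem_ker, LinearMap.ext_iff]
  refine forall_congr' fun a => forall_congr' fun b => ?_
  change a * φ b - φ (a * b) + φ a * b = 0 ↔ _
  rw [sub_add_eq_add_sub, sub_eq_zero, eq_comm]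

theorem coboundaries1_le_cocycles1 : coboundaries1 k A ≤ cocycles1 k A := by
  rintro _ ⟨x, rfl⟩
  rw [mem_cocycles1]
  intro a b
  simp [hochschildD0, mul_sub, sub_mul, mul_assoc]

end Hochschild

/-! ### Projective covers and injective envelopes -/

section Covers

variable {R : Type u} [Ring R] {M : Type v} [AddCommGroup M] [Module R M]
  {S : Type w} [AddCommGroup S] [Module R S]

/-- `π : M → S` is a projective cover: `M` is projective, `π` is onto and its kernel is a
superfluous submodule. -/
structure IsProjectiveCover (π : M →ₗ[R] S) : Prop where
  projective : Module.Projective R M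
  surjective : Function.Surjective π
  superfluous : ∀ N : Submodule R M, N ⊔ LinearMap.ker π = ⊤ → N = ⊤

/-- `ι : S → M` is an injective envelope: `M` is injective, `ι` is one-to-one and its image is an
essential submodule. -/
structure IsInjectiveEnvelope (ι : S →ₗ[R] M) : Prop where
  injective_module : Module.Injective R M
  injective : Function.Injective ι
  essential : ∀ N : Submodule R M, N ⊓ LinearMap.range ι = ⊥ → N = ⊥

end Covers

end QuiverHH

end

open QuiverHH

/-!
The algebra `A = B_{a}` is obtained from `B = kQ / I` by freely adding an element `a = f a e`: a
homomorphism from `A` is a homomorphism `g` from `B` together with an element `c` such that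
`c = g(f) c g(e)` (`exists_isArrowExtension`). Everything about `A` follows from this universal
property, which is recorded as `IsArrowExtension`.

For a finite dimensional algebra, `dim HH¹ = dim Der - dim + dim Z` (`finrank_HH1`), so the point is
to compare derivations. A derivation of `A` is a homomorphism `A → A[ε]` lifting the identity, hence
a derivation `B → A` together with an element of `fAe` (`restrictDerivation_bijective`). Since
`eBf = 0`, a product with two factors `a` vanishes, and as a `B`-bimodule
`A = B ⊕ (Bf ⊗ eB) = B ⊕ Hom_k(D(eB), Bf)`. The projection to the second summand is the matrix entry
of the action of `A` on `Bf ⊕ D(eB)` in which `a` acts through `ξ ↦ ξ(e) f`; a dimension count shows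
that the decomposition is an isomorphism (`IsArrowExtension.exists_decomposition`). Therefore
`dim Der(A) - dim Der(B)` is the dimension of the space of cocycles of `B` with values in
`Hom_k(D(eB), Bf)`, plus `dim fAe = dim fBe + dim fBf dim eBe`
(`IsArrowExtension.finrank_cocycles1`).

For `B`-modules `X` and `Y`, the exact sequence `0 → K → B ⊗ X → X → 0` has a projective middle
term, `Hom_B(B ⊗ X, Y) = Hom_k(X, Y)`, and `Hom_B(K, Y)` is the space of cocycles with values in
`Hom_k(X, Y)`. This gives
`dim Ext¹(X, Y) = dim Z¹(B, Hom_k(X, Y)) - dim Hom_k(X, Y) + dim Hom_B(X, Y)` (`finrank_ext_one`).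

Finally `D(eB)` and `Bf` are the injective envelope and the projective cover of the simple modules
at `e` and `f`, by nilpotency of the ideal of the arrows
(`IsVertexIdempotent.isInjectiveEnvelope`, `IsVertexIdempotent.isProjectiveCover`), and envelopes
and covers are unique up to isomorphism.
-/

noncomputable section

namespace QuiverHH

/-! ### Derivations and Hochschild cohomology in degree one -/

section Derivations

variable {k : Type u} [Field k] {B A : Type v} [Ring B] [Algebra k B] [Ring A] [Algebra k A]

/-- A shortcut: unification does not find the structure of additive group on `M →ₗ[k] N` in the
general instance for vector spaces. -/
instance freeSubmoduleLinearMap {M : Type w} {N : Type z} [AddCommGroup M] [Module k M]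
    [AddCommGroup N] [Module k N] (S : Submodule k (M →ₗ[k] N)) : Module.Free k S :=
  Module.Free.of_divisionRing k S

/-- The derivations of `B` with values in `A`, seen as a `B`-bimodule through an algebra
homomorphism `i : B → A`. -/
def derivationsAlong (i : B →ₐ[k] A) : Submodule k (B →ₗ[k] A) where
  carrier := {d | ∀ b c, d (b * c) = i b * d c + d b * i c}
  add_mem' := by
    intro d d' hd hd' b c
    simp only [LinearMap.add_apply, hd b c, hd' b c, mul_add, add_mul]
    abel
  zero_mem' := by simp
  smul_mem' := by
    intro r d hd b c
    simp only [LinearMap.smul_apply, hd b c, smul_add, mul_smul_comm, smul_mul_assoc]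

/-- The `1`-cocycles of `B` with values in the bimodule `Hom_k(X, Y)`, for left `B`-modules `X`
and `Y`. They are written as maps `B → Hom_k(X, Y)`. -/
def homCocycles (k : Type u) (B : Type v) (X : Type w) (Y : Type z) [Field k] [Ring B]
    [Algebra k B] [AddCommGroup X] [Module k X] [Module B X] [IsScalarTower k B X]
    [AddCommGroup Y] [Module k Y] [Module B Y] [IsScalarTower k B Y] :
    Submodule k (B →ₗ[k] X →ₗ[k] Y) where
  carrier := {d | ∀ b c x, d (b * c) x = b • d c x + d b (c • x)}
  add_mem' := by
    intro d d' hd hd' b c x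
    simp only [LinearMap.add_apply, hd b c, hd' b c, smul_add]
    abel
  zero_mem' := by simp
  smul_mem' := by
    intro r d hd b c x
    simp only [LinearMap.smul_apply, hd b c, smul_add, smul_comm r b]

theorem ker_hochschildD0 :
    LinearMap.ker (hochschildD0 k A) = Subalgebra.toSubmodule (Subalgebra.center k A) := by
  ext x
  rw [LinearMap.mem_ker, Subalgebra.mem_toSubmodule, Subalgebra.mem_center_iff, LinearMap.ext_iff]
  refine forall_congr' fun a => ?_
  change a * x - x * a = 0 ↔ _
  rw [sub_eq_zero]

/-- `dim HH¹(A) = dim Der(A) - dim A + dim Z(A)`, because the inner derivations form a space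
isomorphic to `A / Z(A)`. -/
theorem finrank_HH1 [Module.Finite k A] :
    Module.finrank k (HH1 k A) + Module.finrank k A =
      Module.finrank k (cocycles1 k A) + Module.finrank k (Subalgebra.center k A) := by
  have h1 := Submodule.finrank_quotient_add_finrank (R := k) (M := cocycles1 k A)
    ((coboundaries1 k A).submoduleOf (cocycles1 k A))
  have h2 : Module.finrank k ((coboundaries1 k A).submoduleOf (cocycles1 k A)) =
      Module.finrank k (coboundaries1 k A) :=
    (Submodule.submoduleOfEquivOfLe (coboundaries1_le_cocycles1 k A)).finrank_eq
  have h3 := LinearMap.finrank_range_add_finrank_ker (hochschildD0 k A)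
  rw [ker_hochschildD0] at h3
  change Module.finrank k (coboundaries1 k A) + Module.finrank k (Subalgebra.center k A) = _ at h3
  change Module.finrank k (HH1 k A) + _ = _ at h1
  omega

end Derivations

/-! ### Algebras obtained by adding an arrow -/

section ArrowExtension

variable {k : Type u} [Field k] {B A : Type v} [Ring B] [Algebra k B] [Ring A] [Algebra k A]

/-- `A` is obtained from `B` by freely adding an element `a` such that `a = f a e`: homomorphisms
from `A` are given by their restriction to `B` and the image of `a`. The last field says that `A` is
generated by `B` and `a`. -/
structure IsArrowExtension (i : B →ₐ[k] A) (e f : B) (a : A) : Prop where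
  rel : i f * a * i e = a
  exists_lift : ∀ {C : Type v} [Ring C] [Algebra k C] (g : B →ₐ[k] C) (c : C),
    g f * c * g e = c → ∃ h : A →ₐ[k] C, h.comp i = g ∧ h a = c
  eq_top : ∀ S : Submodule k A, 1 ∈ S → (∀ b, ∀ s ∈ S, i b * s ∈ S) → (∀ s ∈ S, a * s ∈ S) → S = ⊤

variable {i : B →ₐ[k] A} {e f : B} {a : A}

/-- The subspace `xAy`. -/
def cornerOf (k : Type u) {A : Type v} [Field k] [Ring A] [Algebra k A] (x y : A) :
    Submodule k A :=
  LinearMap.range (LinearMap.mulLeft k x ∘ₗ LinearMap.mulRight k y)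

theorem mem_cornerOf {x y : A} (hx : x * x = x) (hy : y * y = y) {c : A} :
    c ∈ cornerOf k x y ↔ x * c * y = c := by
  constructor
  · rintro ⟨c, rfl⟩
    change x * (x * (c * y)) * y = x * (c * y)
    rw [← mul_assoc x x, hx, mul_assoc, mul_assoc, hy]
  · intro h
    exact ⟨c, by simpa [mul_assoc] using h⟩

namespace IsArrowExtension

theorem left_mul (h : IsArrowExtension i e f a) (hf : f * f = f) : i f * a = a := by
  conv_lhs => rw [← h.rel]
  rw [← mul_assoc, ← mul_assoc, ← map_mul, hf, h.rel]

theorem mul_right (h : IsArrowExtension i e f a) (he : e * e = e) : a * i e = a := by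
  conv_lhs => rw [← h.rel]
  rw [mul_assoc, ← map_mul, he, h.rel]

/-- Derivations of `A` are pairs of a derivation `B → A` and an element of `fAe`. The second
component is the part of the image of `a` that the first one does not determine. -/
def restrictDerivation (i : B →ₐ[k] A) (e f : B) (a : A) :
    cocycles1 k A →ₗ[k] derivationsAlong i × cornerOf k (i f) (i e) where
  toFun D := (⟨D.1 ∘ₗ i.toLinearMap, fun b c => by
      simpa using (mem_cocycles1 k A D.1).1 D.2 (i b) (i c)⟩,
    ⟨i f * (D.1 a * i e), ⟨D.1 a, rfl⟩⟩)
  map_add' D D' := by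
    refine Prod.ext (Subtype.ext ?_) (Subtype.ext ?_)
    · rfl
    · simp [mul_add, add_mul]
  map_smul' r D := by
    refine Prod.ext (Subtype.ext ?_) (Subtype.ext ?_)
    · rfl
    · simp

theorem restrictDerivation_bijective (h : IsArrowExtension i e f a) (he : e * e = e)
    (hf : f * f = f) : Function.Bijective (restrictDerivation i e f a) := by
  constructor
  · rw [injective_iff_map_eq_zero]
    intro D hD
    have hD1 : ∀ b, D.1 (i b) = 0 := fun b =>
      LinearMap.congr_fun (congrArg Subtype.val (congrArg Prod.fst hD)) b
    have hD2 : i f * (D.1 a * i e) = 0 := congrArg Subtype.val (congrArg Prod.snd hD)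
    have hleib := (mem_cocycles1 k A D.1).1 D.2
    have ha : D.1 a = 0 := by
      conv_lhs => rw [← h.rel]
      rw [hleib, hleib, hD1, hD1, mul_zero, zero_mul, add_zero, zero_add, mul_assoc, hD2]
    have htop : LinearMap.ker D.1 = ⊤ := by
      refine h.eq_top _ ?_ ?_ ?_
      · simpa using hD1 1
      · intro b s hs
        rw [LinearMap.mem_ker] at hs ⊢
        rw [hleib, hs, hD1, mul_zero, zero_mul, add_zero]
      · intro s hs
        rw [LinearMap.mem_ker] at hs ⊢
        rw [hleib, hs, ha, mul_zero, zero_mul, add_zero]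
    exact Subtype.ext (LinearMap.ker_eq_top.1 htop)
  · rintro ⟨⟨d, hd⟩, ⟨y, hy⟩⟩
    have hy' := (mem_cornerOf (k := k) (by rw [← map_mul, hf]) (by rw [← map_mul, he])).1 hy
    have hfa := h.left_mul hf
    have hae := h.mul_right he
    -- a derivation of `A` is the infinitesimal part of a homomorphism from `A` to `A[ε]`
    let g : B →ₐ[k] TrivSqZeroExt A A := AlgHom.ofLinearMap
      ((TrivSqZeroExt.inlAlgHom k A A).toLinearMap ∘ₗ i.toLinearMap +
        (TrivSqZeroExt.inrHom A A).restrictScalars k ∘ₗ d)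
      (by
        have h1 : d 1 = 0 := by simpa using hd 1 1
        simp [h1])
      (fun b c => by
        ext
        · simp
        · simp [hd b c])
    have hg1 : ∀ b, (g b).fst = i b := fun b => by simp [g]
    have hg2 : ∀ b, (g b).snd = d b := fun b => by simp [g]
    have hfd : i f * d f * a = 0 := by
      have h1 := hd f f
      rw [hf] at h1
      have h2 : i f * d f * i f = 0 := by
        have h3 := congrArg (fun t => i f * t * i f) h1
        simp only [mul_add, add_mul, mul_assoc] at h3
        rw [← map_mul, hf, ← mul_assoc (i f) (i f), ← map_mul, hf] at h3
        rw [mul_assoc]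
        simpa using h3
      rw [← hfa, ← mul_assoc, h2, zero_mul]
    have hde : a * d e * i e = 0 := by
      have h1 := hd e e
      rw [he] at h1
      have h2 : i e * d e * i e = 0 := by
        have h3 := congrArg (fun t => i e * t * i e) h1
        simp only [mul_add, add_mul, mul_assoc] at h3
        rw [← map_mul, he, ← mul_assoc (i e) (i e), ← map_mul, he] at h3
        rw [mul_assoc]
        simpa using h3
      rw [← hae, mul_assoc, mul_assoc, ← mul_assoc (i e), h2, mul_zero]
    let x : A := d f * a + y + a * d e
    have hx : i f * x * i e = y := by
      simp only [x, mul_add, add_mul]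
      rw [hy', ← mul_assoc, hfd, zero_mul, zero_add, ← mul_assoc, hfa, hde, add_zero]
    obtain ⟨ψ, hψ, hψa⟩ := h.exists_lift g (TrivSqZeroExt.inl a + TrivSqZeroExt.inr x) (by
      ext
      · simp [hg1, h.rel]
      · simp only [TrivSqZeroExt.snd_mul, TrivSqZeroExt.fst_mul, hg1, hg2, TrivSqZeroExt.fst_add,
          TrivSqZeroExt.fst_inl, TrivSqZeroExt.fst_inr, TrivSqZeroExt.snd_add, add_zero,
          TrivSqZeroExt.snd_inl, TrivSqZeroExt.snd_inr, zero_add, smul_eq_mul,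
          MulOpposite.smul_eq_mul_unop, MulOpposite.unop_op]
        rw [hfa, add_mul, hx, mul_assoc (d f), hae]
        simp only [x]
        abel)
    have hfst : ∀ α, (ψ α).fst = α := by
      intro α
      have htop : LinearMap.ker ((TrivSqZeroExt.fstHom k A A).toLinearMap ∘ₗ ψ.toLinearMap
          - LinearMap.id) = ⊤ := by
        refine h.eq_top _ ?_ ?_ ?_
        · simp
        · intro b s hs
          have hb : ψ (i b) = g b := DFunLike.congr_fun hψ b
          simp only [LinearMap.mem_ker, LinearMap.sub_apply, LinearMap.comp_apply,
            AlgHom.toLinearMap_apply, TrivSqZeroExt.fstHom_apply, LinearMap.id_apply,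
            sub_eq_zero] at hs ⊢
          rw [map_mul, TrivSqZeroExt.fst_mul, hs, hb, hg1]
        · intro s hs
          simp only [LinearMap.mem_ker, LinearMap.sub_apply, LinearMap.comp_apply,
            AlgHom.toLinearMap_apply, TrivSqZeroExt.fstHom_apply, LinearMap.id_apply,
            sub_eq_zero] at hs ⊢
          rw [map_mul, TrivSqZeroExt.fst_mul, hs, hψa]
          simp
      have := LinearMap.congr_fun (LinearMap.ker_eq_top.1 htop) α
      simpa [sub_eq_zero] using this
    let D : A →ₗ[k] A := (TrivSqZeroExt.sndHom A A).restrictScalars k ∘ₗ ψ.toLinearMap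
    have hDdef : ∀ α, D α = (ψ α).snd := fun α => rfl
    have hD : D ∈ cocycles1 k A := by
      rw [mem_cocycles1]
      intro α β
      rw [hDdef, map_mul, TrivSqZeroExt.snd_mul, hfst, hfst]
      rfl
    refine ⟨⟨D, hD⟩, Prod.ext (Subtype.ext ?_) (Subtype.ext ?_)⟩
    · ext b
      change (ψ (i b)).snd = d b
      rw [show ψ (i b) = g b from DFunLike.congr_fun hψ b, hg2]
    · change i f * ((ψ a).snd * i e) = y
      rw [hψa, ← mul_assoc]
      simpa using hx

end IsArrowExtension

end ArrowExtension

/-! ### The decomposition of the extended algebra as a bimodule -/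

section ArrowExtensionDecomposition

open TensorProduct

variable {k : Type u} [Field k] {B A : Type v} [Ring B] [Algebra k B] [Ring A] [Algebra k A]
variable {i : B →ₐ[k] A} {e f : B} {a : A}

/-- The map `Bf ⊗ eB → A` that inserts the new arrow, `l ⊗ r ↦ l a r`. -/
def insertArrow (i : B →ₐ[k] A) (e f : B) (a : A) :
    LinearMap.range (LinearMap.mulRight k f) ⊗[k] LinearMap.range (LinearMap.mulLeft k e) →ₗ[k] A :=
  TensorProduct.lift ((LinearMap.mul k A).compl₁₂
    (LinearMap.mulRight k a ∘ₗ i.toLinearMap ∘ₗ Submodule.subtype _)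
    (i.toLinearMap ∘ₗ Submodule.subtype _))

@[simp]
theorem insertArrow_tmul (l : LinearMap.range (LinearMap.mulRight k f))
    (r : LinearMap.range (LinearMap.mulLeft k e)) :
    insertArrow i e f a (l ⊗ₜ r) = i l * a * i r := rfl

namespace IsArrowExtension

theorem mem_range_insertArrow (h : IsArrowExtension i e f a) (l r : B) :
    i l * a * i r ∈ LinearMap.range (insertArrow i e f a) := by
  refine ⟨⟨l * f, l, rfl⟩ ⊗ₜ ⟨e * r, r, rfl⟩, ?_⟩
  rw [insertArrow_tmul]
  simp only [map_mul]
  conv_rhs => rw [← h.rel]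
  simp only [mul_assoc]

/-- If `eBf = 0`, the algebra `A` is the sum of `B` and of the image of `Bf ⊗ eB`: a product with
two occurrences of the new arrow vanishes. -/
theorem range_sup_range_insertArrow (h : IsArrowExtension i e f a) (hloop : ∀ b, e * b * f = 0) :
    LinearMap.range i.toLinearMap ⊔ LinearMap.range (insertArrow i e f a) = ⊤ := by
  have haa : ∀ l, a * (i l * a) = 0 := by
    intro l
    rw [← h.rel]
    have : i e * i l * i f = 0 := by rw [← map_mul, ← map_mul, hloop, map_zero]
    calc i f * a * i e * (i l * (i f * a * i e)) = i f * a * (i e * i l * i f) * a * i e := by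
          simp only [mul_assoc]
      _ = 0 := by rw [this]; simp
  have key : ∀ x : A, (∀ b, x * i b ∈ LinearMap.range i.toLinearMap ⊔
      LinearMap.range (insertArrow i e f a)) → (∀ l r, x * (i l * a * i r) ∈
      LinearMap.range i.toLinearMap ⊔ LinearMap.range (insertArrow i e f a)) →
      ∀ s ∈ LinearMap.range i.toLinearMap ⊔ LinearMap.range (insertArrow i e f a),
      x * s ∈ LinearMap.range i.toLinearMap ⊔ LinearMap.range (insertArrow i e f a) := by
    intro x hx1 hx2 s hs
    obtain ⟨_, ⟨c, rfl⟩, _, ⟨t, rfl⟩, rfl⟩ := Submodule.mem_sup.1 hs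
    rw [mul_add]
    refine add_mem (hx1 c) ?_
    induction t with
    | zero => simp
    | tmul l r => exact hx2 l r
    | add t t' ht ht' =>
      rw [map_add, mul_add]
      exact add_mem
        (ht (add_mem (Submodule.mem_sup_left ⟨c, rfl⟩) (Submodule.mem_sup_right ⟨t, rfl⟩)))
        (ht' (add_mem (Submodule.mem_sup_left ⟨c, rfl⟩) (Submodule.mem_sup_right ⟨t', rfl⟩)))
  refine h.eq_top _ ?_ ?_ ?_
  · exact Submodule.mem_sup_left ⟨1, map_one i⟩
  · intro b
    refine key _ (fun c => ?_) (fun l r => ?_)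
    · exact Submodule.mem_sup_left ⟨b * c, map_mul i b c⟩
    · rw [← mul_assoc, ← mul_assoc, ← map_mul]
      exact Submodule.mem_sup_right (h.mem_range_insertArrow _ _)
  · refine key _ (fun c => ?_) (fun l r => ?_)
    · have := h.mem_range_insertArrow 1 c
      rw [map_one, one_mul] at this
      exact Submodule.mem_sup_right this
    · rw [← mul_assoc, haa, zero_mul]
      exact zero_mem _

theorem finite (h : IsArrowExtension i e f a) (hloop : ∀ b, e * b * f = 0) [Module.Finite k B] :
    Module.Finite k A := by
  refine ⟨?_⟩
  rw [← h.range_sup_range_insertArrow hloop]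
  exact Submodule.FG.sup (Submodule.FG.of_finite) (Submodule.FG.of_finite)

theorem finrank_le (h : IsArrowExtension i e f a) (hloop : ∀ b, e * b * f = 0)
    [Module.Finite k B] :
    Module.finrank k A ≤ Module.finrank k B +
      Module.finrank k (LinearMap.range (LinearMap.mulRight k f)) *
        Module.finrank k (LinearMap.range (LinearMap.mulLeft k e)) := by
  have := h.finite hloop
  rw [← finrank_top k A, ← h.range_sup_range_insertArrow hloop, ← Module.finrank_tensorProduct]
  refine (Submodule.finrank_add_le_finrank_add_finrank _ _).trans ?_
  exact add_le_add (LinearMap.finrank_range_le _) (LinearMap.finrank_range_le _)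

variable {X Y : Type v} [AddCommGroup X] [Module k X] [Module B X] [IsScalarTower k B X]
  [AddCommGroup Y] [Module k Y] [Module B Y] [IsScalarTower k B Y]

/-- The retraction of `B → A` that sends the new arrow to zero. -/
theorem exists_retraction (h : IsArrowExtension i e f a) :
    ∃ p : A →ₐ[k] B, (∀ b, p (i b) = b) ∧ p a = 0 := by
  obtain ⟨p, hp, hpa⟩ := h.exists_lift (AlgHom.id k B) 0 (by simp)
  exact ⟨p, fun b => DFunLike.congr_fun hp b, hpa⟩

/-- A linear map `u : X → Y` such that `u = f u e` defines an action of `A` on `Y × X` in which `a`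
acts by `(y, x) ↦ (u x, 0)`. The entry `X → Y` of this action is a map of bimodules
`A → Hom_k(X, Y)` that sends `a` to `u` and vanishes on `B`. -/
theorem exists_toHom (h : IsArrowExtension i e f a) (u : X →ₗ[k] Y)
    (hu : ∀ x, f • u (e • x) = u x) :
    ∃ q : A →ₗ[k] X →ₗ[k] Y, (∀ b α c x, q (i b * α * i c) x = b • q α (c • x)) ∧
      (∀ b, q (i b) = 0) ∧ q a = u := by
  let C := Module.End k (Y × X)
  let g : B →ₐ[k] C := Algebra.lsmul k k (Y × X)
  let c : C := LinearMap.inl k Y X ∘ₗ u ∘ₗ LinearMap.snd k Y X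
  obtain ⟨ψ, hψ, hψa⟩ := h.exists_lift g c (by
    refine LinearMap.ext fun t => Prod.ext ?_ ?_
    · exact hu t.2
    · exact smul_zero f)
  have hb : ∀ b, ψ (i b) = g b := fun b => DFunLike.congr_fun hψ b
  let q : A →ₗ[k] X →ₗ[k] Y :=
    LinearMap.lcomp k Y (LinearMap.inr k Y X) ∘ₗ
      (LinearMap.compRight k (LinearMap.fst k Y X)) ∘ₗ ψ.toLinearMap
  have hq : ∀ α x, q α x = (ψ α (0, x)).1 := fun α x => rfl
  refine ⟨q, ?_, ?_, ?_⟩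
  · intro b α c x
    rw [hq, hq, map_mul, map_mul, hb, hb]
    change b • (ψ α (c • (0, x))).1 = _
    rw [Prod.smul_mk, smul_zero]
  · intro b
    ext x
    rw [hq, hb]
    exact smul_zero b
  · ext x
    rw [hq, hψa]
    rfl

/-- If the bimodule `Hom_k(X, Y)` is generated by `u = f u e` and has the dimension of `Bf ⊗ eB`,
then `A` is the direct sum of `B` and this bimodule. -/
theorem exists_decomposition (h : IsArrowExtension i e f a) (hloop : ∀ b, e * b * f = 0)
    [Module.Finite k B] [Module.Finite k X] [Module.Finite k Y]
    (u : X →ₗ[k] Y) (hu : ∀ x, f • u (e • x) = u x)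
    (hspan : ∀ S : Submodule k (X →ₗ[k] Y),
      (∀ l r : B, (Algebra.lsmul k k Y l) ∘ₗ u ∘ₗ (Algebra.lsmul k k X r) ∈ S) → S = ⊤)
    (hX : Module.finrank k X = Module.finrank k (LinearMap.range (LinearMap.mulLeft k e)))
    (hY : Module.finrank k Y = Module.finrank k (LinearMap.range (LinearMap.mulRight k f))) :
    ∃ (p : A →ₐ[k] B) (q : A →ₗ[k] X →ₗ[k] Y), (∀ b, p (i b) = b) ∧
      (∀ b α c x, q (i b * α * i c) x = b • q α (c • x)) ∧
      Function.Bijective (p.toLinearMap.prod q) := by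
  have := h.finite hloop
  obtain ⟨p, hp, hpa⟩ := h.exists_retraction
  obtain ⟨q, hq, hqi, hqa⟩ := h.exists_toHom u hu
  refine ⟨p, q, hp, hq, ?_⟩
  have hinr : LinearMap.range (LinearMap.inr k B (X →ₗ[k] Y)) ≤
      LinearMap.range (p.toLinearMap.prod q) := by
    rw [LinearMap.range_eq_map, Submodule.map_le_iff_le_comap, top_le_iff]
    refine hspan _ fun l r => ⟨i l * a * i r, Prod.ext ?_ ?_⟩
    · change p (i l * a * i r) = 0
      simp [hpa]
    · change q (i l * a * i r) = _
      ext x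
      rw [hq, hqa]
      rfl
  have hsurj : Function.Surjective (p.toLinearMap.prod q) := by
    rintro ⟨b, n⟩
    obtain ⟨α, hα⟩ := hinr ⟨n, rfl⟩
    refine ⟨i b + α, ?_⟩
    rw [map_add, hα]
    refine Prod.ext ?_ ?_
    · change p (i b) + 0 = b
      rw [hp, add_zero]
    · change q (i b) + n = n
      rw [hqi, zero_add]
  have hle := h.finrank_le hloop
  have hge := LinearMap.finrank_le_finrank_of_surjective hsurj
  have hdim : Module.finrank k (B × (X →ₗ[k] Y)) = Module.finrank k A := by
    refine le_antisymm hge (hle.trans_eq ?_)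
    rw [Module.finrank_prod, Module.finrank_linearMap, hX, hY, mul_comm]
  exact ⟨(LinearMap.injective_iff_surjective_of_finrank_eq_finrank hdim.symm).2 hsurj, hsurj⟩

end IsArrowExtension

/-- For idempotent endomorphisms `E` and `F`, the maps of the form `F h E` are the maps from the
image of `E` to the image of `F`. -/
theorem finrank_range_sandwich {X Y : Type v} [AddCommGroup X] [Module k X] [AddCommGroup Y]
    [Module k Y] [Module.Finite k X] [Module.Finite k Y] (E : X →ₗ[k] X) (F : Y →ₗ[k] Y)
    (hE : E ∘ₗ E = E) (hF : F ∘ₗ F = F) :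
    Module.finrank k (LinearMap.range (LinearMap.compRight k F ∘ₗ LinearMap.lcomp k Y E)) =
      Module.finrank k (LinearMap.range F) * Module.finrank k (LinearMap.range E) := by
  rw [mul_comm, ← Module.finrank_linearMap k k]
  let Ψ : (LinearMap.range E →ₗ[k] LinearMap.range F) →ₗ[k] X →ₗ[k] Y :=
    LinearMap.compRight k (LinearMap.range F).subtype ∘ₗ
      LinearMap.lcomp k (LinearMap.range F) E.rangeRestrict
  have hΨ : Function.Injective Ψ := by
    intro g g' hgg
    ext ⟨_, x, rfl⟩
    exact LinearMap.congr_fun hgg x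
  rw [← LinearMap.finrank_range_of_inj hΨ]
  suffices hrange : LinearMap.range (LinearMap.compRight k F ∘ₗ LinearMap.lcomp k Y E) =
      LinearMap.range Ψ by rw [hrange]
  apply le_antisymm
  · rintro _ ⟨h, rfl⟩
    refine ⟨F.rangeRestrict ∘ₗ h ∘ₗ (LinearMap.range E).subtype, ?_⟩
    ext x
    rfl
  · rintro _ ⟨g, rfl⟩
    refine ⟨Ψ g, ?_⟩
    ext x
    change F (g (E.rangeRestrict (E x))).1 = (g (E.rangeRestrict x)).1
    have h1 : E.rangeRestrict (E x) = E.rangeRestrict x :=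
      Subtype.ext (LinearMap.congr_fun hE x)
    rw [h1]
    obtain ⟨y, hy⟩ := (g (E.rangeRestrict x)).2
    rw [← hy]
    exact LinearMap.congr_fun hF y

theorem finrank_submodule_prod {M : Type w} {N : Type z} [AddCommGroup M] [Module k M]
    [AddCommGroup N] [Module k N] [Module.Finite k M] [Module.Finite k N] (S : Submodule k M)
    (T : Submodule k N) :
    Module.finrank k (S.prod T) = Module.finrank k S + Module.finrank k T := by
  rw [← Module.finrank_prod,
    ← LinearMap.finrank_range_of_inj (f := S.subtype.prodMap T.subtype)
      (Function.Injective.prodMap S.injective_subtype T.injective_subtype),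
    LinearMap.range_prodMap, Submodule.range_subtype, Submodule.range_subtype]

section Decomposition

variable {X Y : Type v} [AddCommGroup X] [Module k X] [Module B X] [IsScalarTower k B X]
  [AddCommGroup Y] [Module k Y] [Module B Y] [IsScalarTower k B Y]

/-- If `A` is the direct sum of `B` and `Hom_k(X, Y)` as a `B`-bimodule, then a derivation `B → A`
is a pair of a derivation of `B` and a cocycle with values in `Hom_k(X, Y)`. -/
theorem finrank_derivationsAlong [Module.Finite k B] [Module.Finite k X] [Module.Finite k Y]
    (p : A →ₐ[k] B) (q : A →ₗ[k] X →ₗ[k] Y) (hp : ∀ b, p (i b) = b)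
    (hq : ∀ b α c x, q (i b * α * i c) x = b • q α (c • x))
    (hpq : Function.Bijective (p.toLinearMap.prod q)) :
    Module.finrank k (derivationsAlong i) =
      Module.finrank k (cocycles1 k B) + Module.finrank k (homCocycles k B X Y) := by
  have hql : ∀ b α x, q (i b * α) x = b • q α x := fun b α x => by simpa using hq b α 1 x
  have hqr : ∀ α c x, q (α * i c) x = q α (c • x) := fun α c x => by simpa using hq 1 α c x
  let Θ := LinearEquiv.ofBijective _ hpq
  rw [← Module.finrank_prod]
  refine LinearEquiv.finrank_eq (LinearEquiv.ofBijective
    ({ toFun := fun d => (⟨p.toLinearMap ∘ₗ d.1, ?_⟩, ⟨q ∘ₗ d.1, ?_⟩)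
       map_add' := ?_
       map_smul' := ?_ } : derivationsAlong i →ₗ[k] cocycles1 k B × homCocycles k B X Y) ⟨?_, ?_⟩)
  · rw [mem_cocycles1]
    intro b c
    simp [d.2 b c, hp]
  · intro b c x
    simp [d.2 b c, hql, hqr]
  · intro d d'
    refine Prod.ext (Subtype.ext ?_) (Subtype.ext ?_)
    · ext; simp
    · ext; simp
  · intro r d
    refine Prod.ext (Subtype.ext ?_) (Subtype.ext ?_)
    · ext; simp
    · ext; simp
  · intro d d' hdd
    refine Subtype.ext (LinearMap.ext fun b => hpq.1 (Prod.ext ?_ ?_))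
    · exact LinearMap.congr_fun (congrArg Subtype.val (congrArg Prod.fst hdd)) b
    · exact LinearMap.congr_fun (congrArg Subtype.val (congrArg Prod.snd hdd)) b
  · rintro ⟨⟨d, hd⟩, ⟨δ, hδ⟩⟩
    rw [mem_cocycles1] at hd
    let D : B →ₗ[k] A := Θ.symm.toLinearMap ∘ₗ d.prod δ
    have hD : ∀ b, (p (D b), q (D b)) = (d b, δ b) := fun b => Θ.apply_symm_apply (d b, δ b)
    have hD1 : ∀ b, p (D b) = d b := fun b => congrArg Prod.fst (hD b)
    have hD2 : ∀ b, q (D b) = δ b := fun b => congrArg Prod.snd (hD b)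
    refine ⟨⟨D, fun b c => hpq.1 (Prod.ext ?_ ?_)⟩, Prod.ext (Subtype.ext ?_) (Subtype.ext ?_)⟩
    · change p (D (b * c)) = p (i b * D c + D b * i c)
      simp [hD1, hp, hd b c]
    · change q (D (b * c)) = q (i b * D c + D b * i c)
      ext x
      simp [hD2, hql, hqr, hδ b c x]
    · ext b
      exact hD1 b
    · ext b : 1
      exact hD2 b

theorem finrank_cornerOf_decomposition [Module.Finite k A] [Module.Finite k B] [Module.Finite k X]
    [Module.Finite k Y]
    (he : e * e = e) (hf : f * f = f)
    (p : A →ₐ[k] B) (q : A →ₗ[k] X →ₗ[k] Y) (hp : ∀ b, p (i b) = b)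
    (hq : ∀ b α c x, q (i b * α * i c) x = b • q α (c • x))
    (hpq : Function.Bijective (p.toLinearMap.prod q)) :
    Module.finrank k (cornerOf k (i f) (i e)) = Module.finrank k (cornerOf k f e) +
      Module.finrank k (LinearMap.range (Algebra.lsmul k k Y f)) *
        Module.finrank k (LinearMap.range (Algebra.lsmul k k X e)) := by
  have hE : (Algebra.lsmul k k X e) ∘ₗ (Algebra.lsmul k k X e) = Algebra.lsmul k k X e := by
    ext x
    simp [← mul_smul, he]
  have hF : (Algebra.lsmul k k Y f) ∘ₗ (Algebra.lsmul k k Y f) = Algebra.lsmul k k Y f := by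
    ext x
    simp [← mul_smul, hf]
  rw [← finrank_range_sandwich _ _ hE hF]
  let Θ := LinearEquiv.ofBijective _ hpq
  let P : A →ₗ[k] A := LinearMap.mulLeft k (i f) ∘ₗ LinearMap.mulRight k (i e)
  let P' : B →ₗ[k] B := LinearMap.mulLeft k f ∘ₗ LinearMap.mulRight k e
  let P'' := LinearMap.compRight k (Algebra.lsmul k k Y f) ∘ₗ
    LinearMap.lcomp k Y (Algebra.lsmul k k X e)
  have hcomm : Θ.toLinearMap ∘ₗ P = P'.prodMap P'' ∘ₗ Θ.toLinearMap := by
    ext α : 1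
    refine Prod.ext ?_ ?_
    · change p (i f * (α * i e)) = f * (p α * e)
      simp [hp]
    · change q (i f * (α * i e)) = P'' (q α)
      ext x
      rw [← mul_assoc, hq]
      rfl
  have h1 := (Θ.submoduleMap (LinearMap.range P)).finrank_eq
  have h2 : Submodule.map (Θ : A →ₗ[k] B × (X →ₗ[k] Y)) (LinearMap.range P) =
      (LinearMap.range P').prod (LinearMap.range P'') := by
    rw [← LinearMap.range_comp, ← LinearMap.range_prodMap]
    change LinearMap.range (Θ.toLinearMap ∘ₗ P) = _
    rw [hcomm, LinearMap.range_comp, LinearEquiv.range, Submodule.map_top]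
  rw [h2] at h1
  exact h1.trans (finrank_submodule_prod _ _)

/-- The dimensions of `A` and of its space of derivations, for `A` the direct sum of `B` and
`Hom_k(X, Y)`. -/
theorem IsArrowExtension.finrank_cocycles1 (h : IsArrowExtension i e f a)
    (he : e * e = e) (hf : f * f = f) (hloop : ∀ b, e * b * f = 0)
    [Module.Finite k B] [Module.Finite k X] [Module.Finite k Y]
    (u : X →ₗ[k] Y) (hu : ∀ x, f • u (e • x) = u x)
    (hspan : ∀ S : Submodule k (X →ₗ[k] Y),
      (∀ l r : B, (Algebra.lsmul k k Y l) ∘ₗ u ∘ₗ (Algebra.lsmul k k X r) ∈ S) → S = ⊤)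
    (hX : Module.finrank k X = Module.finrank k (LinearMap.range (LinearMap.mulLeft k e)))
    (hY : Module.finrank k Y = Module.finrank k (LinearMap.range (LinearMap.mulRight k f))) :
    Module.finrank k A = Module.finrank k B + Module.finrank k (X →ₗ[k] Y) ∧
    Module.finrank k (cocycles1 k A) = Module.finrank k (cocycles1 k B) +
      Module.finrank k (homCocycles k B X Y) + (Module.finrank k (cornerOf k f e) +
      Module.finrank k (LinearMap.range (Algebra.lsmul k k Y f)) *
        Module.finrank k (LinearMap.range (Algebra.lsmul k k X e))) := by
  have := h.finite hloop
  obtain ⟨p, q, hp, hq, hpq⟩ := h.exists_decomposition hloop u hu hspan hX hY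
  constructor
  · rw [← Module.finrank_prod]
    exact (LinearEquiv.ofBijective _ hpq).finrank_eq
  · rw [← finrank_derivationsAlong p q hp hq hpq,
      ← finrank_cornerOf_decomposition he hf p q hp hq hpq, ← Module.finrank_prod]
    exact (LinearEquiv.ofBijective _ (h.restrictDerivation_bijective he hf)).finrank_eq

end Decomposition

end ArrowExtensionDecomposition

/-! ### The first extension group as a space of cocycles -/

section Ext

open Abelian

/-- The beginning of the long exact sequence of a short exact sequence whose middle term is
projective, in terms of dimensions. -/
theorem finrank_ext_one_of_projective {k : Type u} [Field k] {C : Type w} [Category.{v} C]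
    [Abelian C] [Linear k C] [HasExt.{v} C] {S : ShortComplex C} (hS : S.ShortExact)
    [Projective S.X₂] (Y : C) [Module.Finite k (S.X₁ ⟶ Y)] [Module.Finite k (S.X₂ ⟶ Y)] :
    Module.Finite k (Ext S.X₃ Y 1) ∧ Module.Finite k (S.X₃ ⟶ Y) ∧
      Module.finrank k (Ext S.X₃ Y 1) + Module.finrank k (S.X₂ ⟶ Y) =
        Module.finrank k (S.X₁ ⟶ Y) + Module.finrank k (S.X₃ ⟶ Y) := by
  have := hS.mono_f
  have := hS.epi_g
  let res : (S.X₂ ⟶ Y) →ₗ[k] (S.X₁ ⟶ Y) := Linear.leftComp k Y S.f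
  let pre : (S.X₃ ⟶ Y) →ₗ[k] (S.X₂ ⟶ Y) := Linear.leftComp k Y S.g
  let δ : (S.X₁ ⟶ Y) →ₗ[k] Ext S.X₃ Y 1 :=
    Ext.precompOfLinear hS.extClass k Y (add_zero 1) ∘ₗ
      (Ext.linearEquiv₀ (R := k) (X := S.X₁) (Y := Y)).symm.toLinearMap
  have hδ : ∀ h, δ h = hS.extClass.comp (Ext.mk₀ h) (add_zero 1) := fun h => rfl
  have hsurj : Function.Surjective δ := by
    intro x
    obtain ⟨x₁, hx₁⟩ := Ext.contravariant_sequence_exact₃ hS Y x (Ext.eq_zero_of_projective _)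
      (add_zero 1)
    obtain ⟨h, rfl⟩ := (Ext.mk₀_bijective S.X₁ Y).2 x₁
    exact ⟨h, hx₁⟩
  have hker : LinearMap.ker δ = LinearMap.range res := by
    ext h
    rw [LinearMap.mem_ker, hδ]
    constructor
    · intro h0
      obtain ⟨x₂, hx₂⟩ := Ext.contravariant_sequence_exact₁ hS Y _ (add_zero 1) h0
      obtain ⟨g, rfl⟩ := (Ext.mk₀_bijective S.X₂ Y).2 x₂
      rw [Ext.mk₀_comp_mk₀] at hx₂
      exact ⟨g, (Ext.mk₀_bijective S.X₁ Y).1 hx₂⟩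
    · rintro ⟨g, rfl⟩
      change hS.extClass.comp (Ext.mk₀ (S.f ≫ g)) _ = 0
      rw [← Ext.mk₀_comp_mk₀, hS.extClass_comp_assoc]
  have hinj : Function.Injective pre := fun g g' hg => (cancel_epi S.g).1 hg
  have hker' : LinearMap.ker res = LinearMap.range pre := by
    ext g
    rw [LinearMap.mem_ker]
    constructor
    · intro h0
      exact ⟨hS.exact.desc g h0, hS.exact.g_desc g h0⟩
    · rintro ⟨h, rfl⟩
      change S.f ≫ S.g ≫ h = 0
      rw [S.zero_assoc, Limits.zero_comp]
  have hfin := Module.Finite.of_surjective δ hsurj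
  have hfin' := Module.Finite.of_injective pre hinj
  refine ⟨hfin, hfin', ?_⟩
  have h1 := LinearMap.finrank_range_add_finrank_ker δ
  have h2 := LinearMap.finrank_range_add_finrank_ker res
  rw [hker, LinearMap.range_eq_top.2 hsurj, finrank_top] at h1
  rw [hker', LinearMap.finrank_range_of_inj hinj] at h2
  omega

open TensorProduct
open scoped ModuleCat

variable {k : Type u} [Field k] {R : Type v} [Ring R] [Algebra k R]

/-- The multiplication map `R ⊗ X → X`, for `X` an `R`-module. It is onto, and `R ⊗ X` is
projective. -/
def multiplicationMap (k : Type u) [Field k] {R : Type v} [Ring R] [Algebra k R] (X : Type v)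
    [AddCommGroup X] [Module k X] [Module R X] [IsScalarTower k R X] : R ⊗[k] X →ₗ[R] X :=
  TensorProduct.AlgebraTensorModule.lift
    { toFun := fun r => Algebra.lsmul k k X r
      map_add' := fun r s => by ext; simp
      map_smul' := fun r s => by ext x; simp }

section

variable {X : Type v} [AddCommGroup X] [Module k X] [Module R X] [IsScalarTower k R X]

@[simp]
theorem multiplicationMap_tmul (r : R) (x : X) : multiplicationMap k X (r ⊗ₜ[k] x) = r • x := rfl

/-- The projection `t ↦ t - 1 ⊗ μ(t)` of `R ⊗ X` onto the kernel of the multiplication `μ`. -/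
def toKerMultiplication (k : Type u) [Field k] {R : Type v} [Ring R] [Algebra k R] (X : Type v)
    [AddCommGroup X] [Module k X] [Module R X] [IsScalarTower k R X] :
    R ⊗[k] X →ₗ[k] LinearMap.ker (multiplicationMap (R := R) k X) :=
  LinearMap.codRestrict ((LinearMap.ker (multiplicationMap (R := R) k X)).restrictScalars k)
    (LinearMap.id -
      TensorProduct.mk k R X 1 ∘ₗ (multiplicationMap (R := R) k X).restrictScalars k)
    (fun t => by simp)

theorem toKerMultiplication_coe (t : R ⊗[k] X) :
    (toKerMultiplication k X t : R ⊗[k] X) = t - 1 ⊗ₜ multiplicationMap k X t := rfl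

theorem toKerMultiplication_ker (t : LinearMap.ker (multiplicationMap (R := R) k X)) :
    toKerMultiplication k X (t : R ⊗[k] X) = t := by
  refine Subtype.ext ?_
  rw [toKerMultiplication_coe, LinearMap.mem_ker.1 t.2, TensorProduct.tmul_zero, sub_zero]

end

/-- Module homomorphisms from the kernel of `R ⊗ X → X` to `Y` are cocycles with values in
`Hom_k(X, Y)`: the homomorphism `h` gives `r ↦ (x ↦ h (r ⊗ x - 1 ⊗ r x))`. -/
theorem exists_homKer_equiv_homCocycles (X Y : ModuleCat.{v} R) :
    Nonempty ((ModuleCat.of R (LinearMap.ker (multiplicationMap (R := R) k X)) ⟶ Y) ≃ₗ[k]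
      homCocycles k R X Y) := by
  let K := LinearMap.ker (multiplicationMap (R := R) k X)
  have hK : ∀ (r s : R) (x : X), toKerMultiplication k X ((r * s) ⊗ₜ[k] x) =
      r • toKerMultiplication k X (s ⊗ₜ[k] x) + toKerMultiplication k X (r ⊗ₜ[k] (s • x)) := by
    intro r s x
    refine Subtype.ext ?_
    simp only [Submodule.coe_add, Submodule.coe_smul, toKerMultiplication_coe, smul_sub,
      TensorProduct.smul_tmul', multiplicationMap_tmul, smul_eq_mul, mul_one, mul_smul]
    abel
  let Φ : (ModuleCat.of R K ⟶ Y) →ₗ[k] homCocycles k R X Y :=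
    { toFun := fun h => ⟨TensorProduct.curry
        ((h.hom.restrictScalars k : K →ₗ[k] Y) ∘ₗ toKerMultiplication k X), by
          intro r s x
          change h.hom (toKerMultiplication k X ((r * s) ⊗ₜ[k] x)) =
            r • h.hom (toKerMultiplication k X (s ⊗ₜ[k] x)) +
              h.hom (toKerMultiplication k X (r ⊗ₜ[k] (s • x)))
          rw [hK, map_add, map_smul]⟩
      map_add' := fun h h' => by
        refine Subtype.ext ?_
        ext r x
        rfl
      map_smul' := fun c h => by
        refine Subtype.ext ?_
        ext r x
        rfl }
  have hΦ : ∀ h r x, (Φ h).1 r x = h.hom (toKerMultiplication k X (r ⊗ₜ[k] x)) :=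
    fun h r x => rfl
  refine ⟨LinearEquiv.ofBijective Φ ⟨?_, ?_⟩⟩
  · intro h h' hh
    ext t
    have hall : ∀ t : R ⊗[k] X, h.hom (toKerMultiplication k X t) =
        h'.hom (toKerMultiplication k X t) := by
      intro t
      induction t with
      | zero => simp
      | tmul r x => rw [← hΦ, ← hΦ, hh]
      | add t t' ht ht' => rw [map_add, map_add, map_add, ht, ht']
    have := hall t.1
    rwa [toKerMultiplication_ker] at this
  · rintro ⟨d, hd⟩
    have hd1 : ∀ x, d 1 x = 0 := fun x => by simpa using hd 1 1 x
    let D : R ⊗[k] X →ₗ[k] Y := TensorProduct.lift d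
    have hD : ∀ (r : R) (t : R ⊗[k] X), D (r • t) = r • D t + d r (multiplicationMap k X t) := by
      intro r t
      induction t with
      | zero => simp
      | tmul s x => exact hd r s x
      | add t t' ht ht' =>
        rw [smul_add, map_add, map_add, map_add, map_add, ht, ht', smul_add]
        abel
    let h : K →ₗ[R] Y :=
      { toFun := fun t => D t.1
        map_add' := fun t t' => map_add D _ _
        map_smul' := fun r t => by
          change D (r • t.1) = r • D t.1
          rw [hD, LinearMap.mem_ker.1 t.2, map_zero, add_zero] }
    refine ⟨ModuleCat.ofHom h, Subtype.ext ?_⟩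
    ext r x
    rw [hΦ]
    change D (toKerMultiplication k X (r ⊗ₜ[k] x)).1 = d r x
    rw [toKerMultiplication_coe, map_sub]
    change d r x - d 1 (r • x) = d r x
    rw [hd1, sub_zero]

theorem exists_homTensor_equiv (X Y : ModuleCat.{v} R) :
    Nonempty ((ModuleCat.of R (R ⊗[k] X) ⟶ Y) ≃ₗ[k] (X →ₗ[k] Y)) := by
  let Φ : (ModuleCat.of R (R ⊗[k] X) ⟶ Y) →ₗ[k] (X →ₗ[k] Y) :=
    { toFun := fun h =>
        (h.hom.restrictScalars k : R ⊗[k] X →ₗ[k] Y) ∘ₗ TensorProduct.mk k R X 1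
      map_add' := fun h h' => by
        ext x
        rfl
      map_smul' := fun c h => by
        ext x
        rfl }
  have hΦ : ∀ h x, Φ h x = h.hom ((1 : R) ⊗ₜ[k] x) := fun h x => rfl
  refine ⟨LinearEquiv.ofBijective Φ ⟨?_, ?_⟩⟩
  · intro h h' hh
    refine ModuleCat.hom_ext (LinearMap.ext fun (t : R ⊗[k] X) => ?_)
    induction t using TensorProduct.induction_on with
    | zero => simp
    | tmul r x =>
      have h1 : r ⊗ₜ[k] x = r • ((1 : R) ⊗ₜ[k] x) := by
        rw [TensorProduct.smul_tmul', smul_eq_mul, mul_one]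
      rw [h1, map_smul, map_smul, ← hΦ, ← hΦ, hh]
    | add t t' ht ht' => rw [map_add, map_add, ht, ht']
  · intro g
    refine ⟨ModuleCat.ofHom (TensorProduct.AlgebraTensorModule.lift
      { toFun := fun r => (Algebra.lsmul k k Y r) ∘ₗ g
        map_add' := fun r s => by ext; simp
        map_smul' := fun r s => by ext x; simp }), ?_⟩
    ext x
    rw [hΦ]
    exact one_smul R (g x)

/-- `dim Ext¹(X, Y) = dim Z¹(R, Hom_k(X, Y)) - dim Hom_k(X, Y) + dim Hom_R(X, Y)`. -/
theorem finrank_ext_one [Module.Finite k R] (X Y : ModuleCat.{v} R) [Module.Finite k X]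
    [Module.Finite k Y] :
    Module.Finite k (Ext X Y 1) ∧ Module.Finite k (X ⟶ Y) ∧
      Module.finrank k (Ext X Y 1) + Module.finrank k (X →ₗ[k] Y) =
        Module.finrank k (homCocycles k R X Y) + Module.finrank k (X ⟶ Y) := by
  have hS := (multiplicationMap (R := R) k X).shortExact_shortComplexKer
    (fun x => ⟨1 ⊗ₜ x, one_smul R x⟩)
  obtain ⟨e₁⟩ := exists_homKer_equiv_homCocycles (k := k) X Y
  obtain ⟨e₂⟩ := exists_homTensor_equiv (k := k) X Y
  have : Module.Finite k (homCocycles k R X Y) := FiniteDimensional.finiteDimensional_submodule _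
  have f₁ := Module.Finite.equiv e₁.symm
  have f₂ := Module.Finite.equiv e₂.symm
  have : Projective (ModuleCat.of R (R ⊗[k] X)) :=
    (IsProjective.iff_projective _).1 inferInstance
  rw [← e₁.finrank_eq, ← e₂.finrank_eq]
  exact finrank_ext_one_of_projective hS Y

end Ext

/-! ### Uniqueness of projective covers and injective envelopes -/

section Uniqueness

variable {R : Type u} [Ring R]

theorem IsProjectiveCover.nonempty_linearEquiv {P P' S : Type v} [AddCommGroup P] [Module R P]
    [AddCommGroup P'] [Module R P'] [AddCommGroup S] [Module R S] {π : P →ₗ[R] S}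
    {π' : P' →ₗ[R] S} (hπ : IsProjectiveCover π) (hπ' : IsProjectiveCover π') :
    Nonempty (P ≃ₗ[R] P') := by
  have := hπ.projective
  have := hπ'.projective
  obtain ⟨g, hg⟩ := Module.projective_lifting_property π' π hπ'.surjective
  have hg' : ∀ x, π' (g x) = π x := fun x => LinearMap.congr_fun hg x
  have hgsurj : Function.Surjective g := by
    rw [← LinearMap.range_eq_top]
    refine hπ'.superfluous _ (eq_top_iff.2 fun y _ => ?_)
    obtain ⟨x, hx⟩ := hπ.surjective (π' y)
    refine Submodule.mem_sup.2 ⟨g x, ⟨x, rfl⟩, y - g x, ?_, by abel⟩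
    rw [LinearMap.mem_ker, map_sub, hg', hx, sub_self]
  obtain ⟨s, hs⟩ := Module.projective_lifting_property g LinearMap.id hgsurj
  have hs' : ∀ y, g (s y) = y := fun y => LinearMap.congr_fun hs y
  have hssurj : Function.Surjective s := by
    rw [← LinearMap.range_eq_top]
    refine hπ.superfluous _ (eq_top_iff.2 fun x _ => ?_)
    refine Submodule.mem_sup.2 ⟨s (g x), ⟨g x, rfl⟩, x - s (g x), ?_, by abel⟩
    rw [LinearMap.mem_ker, map_sub, ← hg', ← hg', hs', sub_self]
  exact ⟨(LinearEquiv.ofBijective s ⟨Function.LeftInverse.injective hs', hssurj⟩).symm⟩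

theorem IsInjectiveEnvelope.nonempty_linearEquiv {J J' S : Type v} [AddCommGroup J] [Module R J]
    [AddCommGroup J'] [Module R J'] [AddCommGroup S] [Module R S] {ι : S →ₗ[R] J}
    {ι' : S →ₗ[R] J'} (hι : IsInjectiveEnvelope ι) (hι' : IsInjectiveEnvelope ι') :
    Nonempty (J ≃ₗ[R] J') := by
  obtain ⟨g, hg⟩ := hι'.injective_module.out ι hι.injective ι'
  have hginj : Function.Injective g := by
    rw [← LinearMap.ker_eq_bot]
    refine hι.essential _ (eq_bot_iff.2 ?_)
    rintro _ ⟨hx, s, rfl⟩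
    rw [SetLike.mem_coe, LinearMap.mem_ker, hg] at hx
    rw [Submodule.mem_bot, hι'.injective (hx.trans (map_zero ι').symm), map_zero]
  obtain ⟨r, hr⟩ := hι.injective_module.out g hginj LinearMap.id
  have hrinj : Function.Injective r := by
    rw [← LinearMap.ker_eq_bot]
    refine hι'.essential _ (eq_bot_iff.2 ?_)
    rintro _ ⟨hx, s, rfl⟩
    rw [SetLike.mem_coe, LinearMap.mem_ker, ← hg, hr, LinearMap.id_apply] at hx
    rw [Submodule.mem_bot, hι.injective (hx.trans (map_zero ι).symm), map_zero]
  exact ⟨LinearEquiv.ofBijective g ⟨hginj, fun y => ⟨r y, hrinj (hr (r y))⟩⟩⟩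

end Uniqueness

/-! ### The projective cover and the injective envelope given by an idempotent -/

section Idempotent

variable {k : Type u} [Field k] {B : Type v} [Ring B] [Algebra k B]

/-- The dual of the right regular module of `B`, with the left action `(b ξ)(x) = ξ(x b)`. -/
def RegularDual (k : Type u) (B : Type v) [Field k] [Ring B] [Algebra k B] : Type max u v :=
  Module.Dual k B

namespace RegularDual

instance : AddCommGroup (RegularDual k B) := inferInstanceAs (AddCommGroup (Module.Dual k B))

instance : Module k (RegularDual k B) := inferInstanceAs (Module k (Module.Dual k B))

/-- The underlying linear form. -/
def toDual : RegularDual k B ≃ₗ[k] Module.Dual k B := LinearEquiv.refl k _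

instance : Module B (RegularDual k B) where
  smul b ξ := toDual.symm (toDual ξ ∘ₗ LinearMap.mulRight k b)
  one_smul ξ := by
    refine toDual.injective (LinearMap.ext fun x => ?_)
    exact congrArg (toDual ξ) (mul_one x)
  mul_smul b c ξ := by
    refine toDual.injective (LinearMap.ext fun x => ?_)
    exact congrArg (toDual ξ) (mul_assoc x b c).symm
  smul_zero b := rfl
  smul_add b ξ η := rfl
  add_smul b c ξ := by
    refine toDual.injective (LinearMap.ext fun x => ?_)
    exact (congrArg (toDual ξ) (mul_add x b c)).trans (map_add _ _ _)
  zero_smul ξ := by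
    refine toDual.injective (LinearMap.ext fun x => ?_)
    exact (congrArg (toDual ξ) (mul_zero x)).trans (map_zero _)

@[simp]
theorem toDual_smul_apply (b : B) (ξ : RegularDual k B) (x : B) :
    toDual (b • ξ) x = toDual ξ (x * b) := rfl

instance : IsScalarTower k B (RegularDual k B) where
  smul_assoc c b ξ := by
    refine toDual.injective (LinearMap.ext fun x => ?_)
    rw [toDual_smul_apply, mul_smul_comm, map_smul, map_smul, LinearMap.smul_apply, toDual_smul_apply]

end RegularDual

open RegularDual

/-- The dual `D(eB)` of the right ideal `eB`, for `e` idempotent: the linear forms `ξ` on `B` such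
that `ξ(e b) = ξ(b)`, which are determined by their restriction to `eB`. -/
def cornerDual (k : Type u) {B : Type v} [Field k] [Ring B] [Algebra k B] (e : B) :
    Submodule B (RegularDual k B) where
  carrier := {ξ | ∀ b, toDual ξ (e * b) = toDual ξ b}
  add_mem' := fun {ξ η} hξ hη b => by
    rw [map_add, LinearMap.add_apply, LinearMap.add_apply, hξ, hη]
  zero_mem' := fun b => rfl
  smul_mem' := fun c ξ hξ b => by
    rw [toDual_smul_apply, toDual_smul_apply, mul_assoc, hξ]

/-- The left ideal `Bf`. -/
def leftIdeal (f : B) : Submodule B B := LinearMap.range (LinearMap.toSpanSingleton B B f)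

theorem self_mem_leftIdeal (f : B) : f ∈ leftIdeal f := ⟨1, one_mul f⟩

theorem mem_leftIdeal {f : B} (hf : f * f = f) {b : B} : b ∈ leftIdeal f ↔ b * f = b := by
  constructor
  · rintro ⟨c, rfl⟩
    change c * f * f = c * f
    rw [mul_assoc, hf]
  · intro h
    exact ⟨b, h⟩

/-- The module `D(eB)` is injective: `Hom_B(M, D(eB))` is the dual of the vector space `eM`. -/
theorem injective_cornerDual {B : Type max u v} [Ring B] [Algebra k B] {e : B} (he : e * e = e) :
    Module.Injective B (cornerDual k e) := by
  refine ⟨fun M N _ _ _ _ j hj g => ?_⟩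
  let : Module k M := Module.restrictScalars k B M
  let : Module k N := Module.restrictScalars k B N
  have : IsScalarTower k B M := IsScalarTower.restrictScalars k B M
  have : IsScalarTower k B N := IsScalarTower.restrictScalars k B N
  let φ : M →ₗ[k] k :=
    LinearMap.applyₗ (1 : B) ∘ₗ toDual.toLinearMap ∘ₗ
      ((cornerDual k e).subtype ∘ₗ g).restrictScalars k
  have hφ : ∀ m, φ m = toDual (g m).1 1 := fun m => rfl
  obtain ⟨r, hr⟩ := LinearMap.exists_leftInverse_of_injective (j.restrictScalars k)
    (LinearMap.ker_eq_bot.2 hj)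
  let ψ : N →ₗ[k] k := φ ∘ₗ r
  have hψ : ∀ m, ψ (j m) = φ m := fun m => congrArg φ (LinearMap.congr_fun hr m)
  let G : N →ₗ[B] cornerDual k e :=
    { toFun := fun n => ⟨toDual.symm (ψ ∘ₗ
          (LinearMap.toSpanSingleton B N n).restrictScalars k ∘ₗ LinearMap.mulLeft k e), by
        intro b
        change ψ ((e * (e * b)) • n) = ψ ((e * b) • n)
        rw [← mul_assoc, he]⟩
      map_add' := fun n n' => by
        refine Subtype.ext (toDual.injective (LinearMap.ext fun b => ?_))
        change ψ ((e * b) • (n + n')) = ψ ((e * b) • n) + ψ ((e * b) • n')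
        rw [smul_add, map_add]
      map_smul' := fun c n => by
        refine Subtype.ext (toDual.injective (LinearMap.ext fun b => ?_))
        change ψ ((e * b) • c • n) = ψ ((e * (b * c)) • n)
        rw [← mul_smul, mul_assoc] }
  refine ⟨G, fun m => Subtype.ext (toDual.injective (LinearMap.ext fun b => ?_))⟩
  change ψ ((e * b) • j m) = toDual (g m).1 b
  rw [← map_smul, hψ, hφ, map_smul, Submodule.coe_smul, toDual_smul_apply, one_mul]
  exact (g m).2 b

theorem projective_leftIdeal {f : B} (hf : f * f = f) : Module.Projective B (leftIdeal f) := by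
  refine Module.Projective.of_split (leftIdeal f).subtype
    (LinearMap.toSpanSingleton B B f).rangeRestrict (LinearMap.ext fun b => Subtype.ext ?_)
  exact (mem_leftIdeal hf).1 b.2

/-- The idempotent `e` behaves like a vertex of a bound quiver algebra: `b e - χ(b) e` lies in `r` for
all `b`, where `r` plays the role of the radical of `B`, and `χ` is the character of `B` given by the
coefficient of `e`. -/
structure IsVertexIdempotent (e : B) (r : Submodule k B) (χ : B →ₐ[k] k) : Prop where
  idem : e * e = e
  char_eq_one : χ e = 1
  mul_mem : ∀ b, ∀ x ∈ r, b * x ∈ r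
  nilpotent : ∃ n, r ^ n = ⊥
  sub_mem : ∀ b, b * e - χ b • e ∈ r

namespace IsVertexIdempotent

variable {e : B} {r : Submodule k B} {χ : B →ₐ[k] k}

theorem isNilpotent (h : IsVertexIdempotent e r χ) {x : B} (hx : x ∈ r) : IsNilpotent x := by
  obtain ⟨n, hn⟩ := h.nilpotent
  exact ⟨n, by simpa [hn] using Submodule.pow_mem_pow r hx n⟩

theorem char_eq_zero (h : IsVertexIdempotent e r χ) {x : B} (hx : x ∈ r) : χ x = 0 :=
  ((h.isNilpotent hx).map χ).eq_zero

theorem char_eq_zero_iff (h : IsVertexIdempotent e r χ) {b : B} : χ b = 0 ↔ b * e ∈ r := by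
  constructor
  · intro hb
    simpa [hb] using h.sub_mem b
  · intro hb
    simpa [h.char_eq_one] using h.char_eq_zero hb

/-- The left ideal `Bf` is the projective cover of its simple top. -/
theorem isProjectiveCover (h : IsVertexIdempotent e r χ) {J : Submodule B B}
    (hJ : ∀ b, b ∈ J ↔ b * e ∈ r) :
    IsProjectiveCover (J.mkQ ∘ₗ (leftIdeal e).subtype) where
  projective := projective_leftIdeal h.idem
  surjective := by
    intro s
    obtain ⟨b, rfl⟩ := J.mkQ_surjective s
    refine ⟨⟨b * e, b, rfl⟩, ?_⟩
    refine (Submodule.Quotient.eq J).2 ((hJ _).2 ?_)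
    change (b * e - b) * e ∈ r
    rw [sub_mul, mul_assoc, h.idem, sub_self]
    exact zero_mem r
  superfluous := by
    intro N hN
    obtain ⟨n, hn, x, hx, hnx⟩ := Submodule.mem_sup.1
      (hN ▸ Submodule.mem_top (x := (⟨e, 1, one_mul e⟩ : leftIdeal e)))
    have hx' : x.1 ∈ r := by
      have h1 : x.1 ∈ J := (Submodule.Quotient.mk_eq_zero J).1 hx
      rw [hJ, (mem_leftIdeal h.idem).1 x.2] at h1
      exact h1
    -- `e = n + x` with `x` nilpotent, so `e` is a multiple of `n = (1 - x) e`
    obtain ⟨v, hv⟩ := (h.isNilpotent hx').isUnit_one_sub.exists_left_inv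
    have hval : n.1 + x.1 = e := congrArg Subtype.val hnx
    have hn' : n.1 = (1 - x.1) * e := by
      rw [sub_mul, one_mul, (mem_leftIdeal h.idem).1 x.2]
      exact eq_sub_of_add_eq hval
    refine eq_top_iff.2 fun b _ => ?_
    have hb : b = (b.1 * v) • n := by
      refine Subtype.ext ?_
      change b.1 = b.1 * v * n.1
      rw [hn', mul_assoc, ← mul_assoc v, hv, one_mul, (mem_leftIdeal h.idem).1 b.2]
    rw [hb]
    exact N.smul_mem _ hn

theorem char_mem_cornerDual (h : IsVertexIdempotent e r χ) :
    toDual.symm χ.toLinearMap ∈ cornerDual k e := by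
  intro b
  change χ (e * b) = χ b
  rw [map_mul, h.char_eq_one, one_mul]

/-- The map from the simple module at `e` to `D(eB)` with value `χ` at the class of `1`. -/
def toCornerDual (h : IsVertexIdempotent e r χ) {J : Submodule B B}
    (hJ : ∀ b, b ∈ J ↔ b * e ∈ r) : B ⧸ J →ₗ[B] cornerDual k e :=
  J.liftQ (LinearMap.toSpanSingleton B _ ⟨toDual.symm χ.toLinearMap, h.char_mem_cornerDual⟩) (by
    intro b hb
    refine LinearMap.mem_ker.2 (Subtype.ext (toDual.injective (LinearMap.ext fun x => ?_)))
    change χ (x * b) = 0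
    rw [map_mul, h.char_eq_zero_iff.2 ((hJ b).1 hb), mul_zero])

theorem toDual_toCornerDual (h : IsVertexIdempotent e r χ) {J : Submodule B B}
    (hJ : ∀ b, b ∈ J ↔ b * e ∈ r) (b x : B) :
    toDual (h.toCornerDual hJ (J.mkQ b)).1 x = χ x * χ b := map_mul χ x b

/-- The module `D(eB)` is the injective envelope of the simple module at `e`: a nonzero linear form
in it has a multiple that is `χ` up to a scalar. -/
theorem isInjectiveEnvelope {B : Type max u v} [Ring B] [Algebra k B] {e : B}
    {r : Submodule k B} {χ : B →ₐ[k] k} (h : IsVertexIdempotent e r χ) {J : Submodule B B}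
    (hJ : ∀ b, b ∈ J ↔ b * e ∈ r) : IsInjectiveEnvelope (h.toCornerDual hJ) where
  injective_module := injective_cornerDual h.idem
  injective := by
    rw [injective_iff_map_eq_zero]
    intro s hs
    obtain ⟨b, rfl⟩ := J.mkQ_surjective s
    have h1 := h.toDual_toCornerDual hJ b 1
    rw [hs, map_one χ, one_mul] at h1
    exact (Submodule.Quotient.mk_eq_zero J).2 ((hJ b).2 (h.char_eq_zero_iff.1 h1.symm))
  essential := by
    intro U hU
    by_contra hne
    obtain ⟨ξ, hξU, hξ⟩ := Submodule.exists_mem_ne_zero_of_ne_bot hne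
    have hξe : ∀ b, toDual ξ.1 (e * b) = toDual ξ.1 b := ξ.2
    obtain ⟨n, hn⟩ := h.nilpotent
    -- `x` is taken in the last term on which `ξ` does not vanish of the filtration by the `r ^ m B`
    have hex : ∃ m, ∀ x ∈ r ^ m * (⊤ : Submodule k B), toDual ξ.1 x = 0 := by
      refine ⟨n, fun x hx => ?_⟩
      rw [hn, Submodule.bot_mul, Submodule.mem_bot] at hx
      rw [hx, map_zero]
    classical
    have hspec := Nat.find_spec hex
    obtain ⟨m, hm⟩ : ∃ m, Nat.find hex = m + 1 := by
      refine Nat.exists_eq_succ_of_ne_zero fun h0 => ?_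
      rw [h0, pow_zero, one_mul] at hspec
      exact hξ (Subtype.ext (toDual.injective (LinearMap.ext fun x => hspec x trivial)))
    have hmin := Nat.find_min hex (m := m) (by rw [hm]; exact Nat.lt_succ_self m)
    push Not at hmin
    obtain ⟨x, hx, hξx⟩ := hmin
    rw [hm, pow_succ', mul_assoc] at hspec
    have hval : ∀ y, toDual ((e * x) • ξ).1 y = χ y * toDual ξ.1 x := by
      intro y
      rw [Submodule.coe_smul, toDual_smul_apply, ← mul_assoc,
        ← sub_add_cancel (y * e) (χ y • e), add_mul, map_add,
        hspec _ (Submodule.mul_mem_mul (h.sub_mem y) hx), zero_add, smul_mul_assoc, map_smul, hξe,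
        smul_eq_mul]
    have hmem : (e * x) • ξ ∈ U ⊓ LinearMap.range (h.toCornerDual hJ) := by
      refine ⟨U.smul_mem _ hξU, J.mkQ (algebraMap k B (toDual ξ.1 x)), ?_⟩
      refine Subtype.ext (toDual.injective (LinearMap.ext fun y => ?_))
      rw [h.toDual_toCornerDual hJ, hval, AlgHom.commutes]
      rfl
    rw [hU, Submodule.mem_bot] at hmem
    have h0 := hval 1
    rw [hmem, map_one χ, one_mul] at h0
    exact hξx h0.symm

end IsVertexIdempotent

end Idempotent

/-! ### The bimodule of linear maps from `D(eB)` to `Bf` -/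

section Corners

open RegularDual

variable {k : Type u} [Field k] {B : Type v} [Ring B] [Algebra k B] {e f : B}
  {X : Type w} [AddCommGroup X] [Module k X] [Module B X] [IsScalarTower k B X]
  {Y : Type z} [AddCommGroup Y] [Module k Y] [Module B Y] [IsScalarTower k B Y]

/-- A module isomorphic to `Bf`, as a subspace of `B`. -/
def toAlgebra (τ : Y ≃ₗ[B] leftIdeal f) : Y →ₗ[k] B :=
  ((leftIdeal f).subtype ∘ₗ τ.toLinearMap).restrictScalars k

theorem toAlgebra_injective (τ : Y ≃ₗ[B] leftIdeal f) :
    Function.Injective (toAlgebra (k := k) τ) :=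
  Subtype.val_injective.comp τ.injective

theorem range_toAlgebra (τ : Y ≃ₗ[B] leftIdeal f) :
    LinearMap.range (toAlgebra (k := k) τ) = LinearMap.range (LinearMap.mulRight k f) := by
  apply le_antisymm
  · rintro _ ⟨y, rfl⟩
    exact (τ y).2
  · rintro _ ⟨b, rfl⟩
    exact ⟨τ.symm ⟨b * f, b, rfl⟩, congrArg Subtype.val (τ.apply_symm_apply _)⟩

theorem finrank_eq_of_equiv_leftIdeal (τ : Y ≃ₗ[B] leftIdeal f) :
    Module.finrank k Y = Module.finrank k (LinearMap.range (LinearMap.mulRight k f)) := by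
  rw [← range_toAlgebra τ, LinearMap.finrank_range_of_inj (toAlgebra_injective τ)]

theorem finrank_lsmul_of_equiv_leftIdeal (τ : Y ≃ₗ[B] leftIdeal f) :
    Module.finrank k (LinearMap.range (Algebra.lsmul k k Y f)) =
      Module.finrank k (cornerOf k f f) := by
  have h : Submodule.map (toAlgebra (k := k) τ) (LinearMap.range (Algebra.lsmul k k Y f)) =
      cornerOf k f f := by
    rw [← LinearMap.range_comp]
    have h1 : toAlgebra (k := k) τ ∘ₗ (Algebra.lsmul k k Y f) =
        LinearMap.mulLeft k f ∘ₗ toAlgebra τ := by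
      ext y
      exact congrArg Subtype.val (map_smul τ f y)
    rw [h1, LinearMap.range_comp, range_toAlgebra, ← LinearMap.range_comp]
    rfl
  rw [← h]
  exact (Submodule.equivMapOfInjective _ (toAlgebra_injective τ) _).finrank_eq

/-- A module isomorphic to `D(eB)`, as a space of linear forms on `B`. -/
def toLinearForm (σ : X ≃ₗ[B] cornerDual k e) : X →ₗ[k] Module.Dual k B :=
  toDual.toLinearMap ∘ₗ ((cornerDual k e).subtype ∘ₗ σ.toLinearMap).restrictScalars k

theorem toLinearForm_injective (σ : X ≃ₗ[B] cornerDual k e) :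
    Function.Injective (toLinearForm σ) :=
  toDual.injective.comp (Subtype.val_injective.comp σ.injective)

theorem toLinearForm_smul (σ : X ≃ₗ[B] cornerDual k e) (b : B) (x : X) (c : B) :
    toLinearForm σ (b • x) c = toLinearForm σ x (c * b) := by
  change toDual (σ (b • x)).1 c = toDual (σ x).1 (c * b)
  rw [map_smul, Submodule.coe_smul, toDual_smul_apply]

theorem toLinearForm_mul (σ : X ≃ₗ[B] cornerDual k e) (x : X) (c : B) :
    toLinearForm σ x (e * c) = toLinearForm σ x c := (σ x).2 c

theorem range_toLinearForm (he : e * e = e) (σ : X ≃ₗ[B] cornerDual k e) :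
    LinearMap.range (toLinearForm σ) = LinearMap.range (LinearMap.mulLeft k e).dualMap := by
  apply le_antisymm
  · rintro _ ⟨x, rfl⟩
    exact ⟨toLinearForm σ x, LinearMap.ext fun c => toLinearForm_mul σ x c⟩
  · rintro _ ⟨φ, rfl⟩
    have hmem : toDual.symm ((LinearMap.mulLeft k e).dualMap φ) ∈ cornerDual k e := by
      intro b
      change φ (e * (e * b)) = φ (e * b)
      rw [← mul_assoc, he]
    exact ⟨σ.symm ⟨_, hmem⟩,
      congrArg (fun t : cornerDual k e => toDual t.1) (σ.apply_symm_apply ⟨_, hmem⟩)⟩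

theorem finrank_eq_of_equiv_cornerDual [Module.Finite k B] (he : e * e = e)
    (σ : X ≃ₗ[B] cornerDual k e) :
    Module.finrank k X = Module.finrank k (LinearMap.range (LinearMap.mulLeft k e)) := by
  rw [← LinearMap.finrank_range_dualMap_eq_finrank_range, ← range_toLinearForm he σ,
    LinearMap.finrank_range_of_inj (toLinearForm_injective σ)]

theorem finrank_lsmul_of_equiv_cornerDual [Module.Finite k B] (he : e * e = e)
    (σ : X ≃ₗ[B] cornerDual k e) :
    Module.finrank k (LinearMap.range (Algebra.lsmul k k X e)) =
      Module.finrank k (cornerOf k e e) := by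
  have h : Submodule.map (toLinearForm σ) (LinearMap.range (Algebra.lsmul k k X e)) =
      LinearMap.range (LinearMap.mulLeft k e ∘ₗ LinearMap.mulRight k e).dualMap := by
    rw [← LinearMap.range_comp]
    have h1 : toLinearForm σ ∘ₗ (Algebra.lsmul k k X e) =
        (LinearMap.mulRight k e).dualMap ∘ₗ toLinearForm σ := by
      ext x c
      exact toLinearForm_smul σ e x c
    rw [h1, LinearMap.range_comp, range_toLinearForm he, ← LinearMap.range_comp]
    rfl
  rw [cornerOf, ← LinearMap.finrank_range_dualMap_eq_finrank_range (LinearMap.mulLeft k e ∘ₗ _), ← h]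
  exact (Submodule.equivMapOfInjective _ (toLinearForm_injective σ) _).finrank_eq

/-- The element `e ⊗ f` of `eB ⊗ Bf = Hom_k(D(eB), Bf)`, transported to modules isomorphic to
`D(eB)` and `Bf`. -/
def homGenerator (σ : X ≃ₗ[B] cornerDual k e) (τ : Y ≃ₗ[B] leftIdeal f) : X →ₗ[k] Y :=
  (LinearMap.applyₗ (1 : B) ∘ₗ toLinearForm σ).smulRight (τ.symm ⟨f, self_mem_leftIdeal f⟩)

theorem smul_homGenerator_smul (hf : f * f = f) (σ : X ≃ₗ[B] cornerDual k e)
    (τ : Y ≃ₗ[B] leftIdeal f) (x : X) :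
    f • homGenerator σ τ (e • x) = homGenerator σ τ x := by
  change f • toLinearForm σ (e • x) 1 • τ.symm ⟨f, self_mem_leftIdeal f⟩ =
    toLinearForm σ x 1 • τ.symm ⟨f, self_mem_leftIdeal f⟩
  have h1 : toLinearForm σ (e • x) 1 = toLinearForm σ x 1 := by
    rw [toLinearForm_smul, one_mul, ← toLinearForm_mul σ x 1, mul_one]
  have h2 : f • (⟨f, self_mem_leftIdeal f⟩ : leftIdeal f) = ⟨f, self_mem_leftIdeal f⟩ :=
    Subtype.ext hf
  rw [h1, smul_comm, ← map_smul, h2]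

/-- The space `Hom_k(X, Y)`, for `X` and `Y` isomorphic to `D(eB)` and `Bf`, is spanned by the
multiples of `homGenerator`: these are the linear maps of rank one. -/
theorem eq_top_of_homGenerator_mem [Module.Finite k B] [Module.Finite k X]
    (σ : X ≃ₗ[B] cornerDual k e) (τ : Y ≃ₗ[B] leftIdeal f) (S : Submodule k (X →ₗ[k] Y))
    (hS : ∀ l r : B,
      (Algebra.lsmul k k Y l) ∘ₗ homGenerator σ τ ∘ₗ (Algebra.lsmul k k X r) ∈ S) : S = ⊤ := by
  refine eq_top_iff.2 fun h _ => ?_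
  obtain ⟨t, rfl⟩ := (dualTensorHomEquiv k X Y).surjective h
  induction t with
  | zero => rw [map_zero]; exact zero_mem S
  | add t t' ht ht' => rw [map_add]; exact add_mem (ht trivial) (ht' trivial)
  | tmul φ y =>
    -- a linear form on `X` is the evaluation at an element of `B`
    obtain ⟨φ', hφ'⟩ : ∃ φ' : Module.Dual k (Module.Dual k B), φ' ∘ₗ toLinearForm σ = φ := by
      obtain ⟨r, hr⟩ := LinearMap.exists_leftInverse_of_injective (toLinearForm σ)
        (LinearMap.ker_eq_bot.2 (toLinearForm_injective σ))
      exact ⟨φ ∘ₗ r, by rw [LinearMap.comp_assoc, hr, LinearMap.comp_id]⟩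
    obtain ⟨b, rfl⟩ := (Module.evalEquiv k B).surjective φ'
    obtain ⟨l, hl⟩ := (τ y).2
    convert hS l b
    ext x
    have h1 : y = l • τ.symm ⟨f, self_mem_leftIdeal f⟩ := by
      rw [← map_smul, LinearEquiv.eq_symm_apply]
      exact Subtype.ext hl.symm
    have h2 : φ x = toLinearForm σ x b := by
      rw [← hφ']
      rfl
    change φ x • y = l • toLinearForm σ (b • x) 1 • τ.symm ⟨f, self_mem_leftIdeal f⟩
    rw [toLinearForm_smul, one_mul, smul_comm, ← h1, h2]

end Corners

/-! ### Homomorphisms from path algebras and bound quiver algebras -/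

section Lift

variable {k : Type u} [Field k] {V : Type v} [Quiver.{w} V] [Fintype V]
variable {C : Type z} [Ring C] [Algebra k C]

/-- A representation of the quiver `V` inside an algebra `C`: the vertices are sent to orthogonal
idempotents with sum `1`, and an arrow from `x` to `y` to an element of `yCx`. -/
structure AlgebraRep (V : Type v) [Quiver.{w} V] [Fintype V] (C : Type z) [Ring C] where
  /-- The image of a vertex. -/
  vertex : V → C
  /-- The image of an arrow. -/
  arrow : ∀ {x y : V}, (x ⟶ y) → C
  vertex_mul_self : ∀ x, vertex x * vertex x = vertex x
  vertex_mul_of_ne : ∀ x y, x ≠ y → vertex x * vertex y = 0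
  sum_vertex : ∑ x, vertex x = 1
  vertex_mul_arrow : ∀ {x y : V} (a : x ⟶ y), vertex y * arrow a = arrow a
  arrow_mul_vertex : ∀ {x y : V} (a : x ⟶ y), arrow a * vertex x = arrow a

namespace AlgebraRep

variable (ρ : AlgebraRep V C)

/-- The image of a path, the product of the images of its arrows from right to left. -/
def path {x : V} : ∀ {y : V}, Quiver.Path x y → C
  | _, .nil => ρ.vertex x
  | _, .cons p a => ρ.arrow a * path p

@[simp]
theorem path_nil (x : V) : ρ.path (Quiver.Path.nil : Quiver.Path x x) = ρ.vertex x := rfl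

@[simp]
theorem path_cons {x y y' : V} (p : Quiver.Path x y) (a : y ⟶ y') :
    ρ.path (p.cons a) = ρ.arrow a * ρ.path p := rfl

theorem vertex_mul_path {x y : V} (p : Quiver.Path x y) : ρ.vertex y * ρ.path p = ρ.path p := by
  cases p with
  | nil => exact ρ.vertex_mul_self x
  | cons p a => rw [path_cons, ← mul_assoc, ρ.vertex_mul_arrow]

theorem path_mul_vertex {x y : V} (p : Quiver.Path x y) : ρ.path p * ρ.vertex x = ρ.path p := by
  induction p with
  | nil => exact ρ.vertex_mul_self x
  | cons p a ih => rw [path_cons, mul_assoc, ih]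

theorem path_comp {x y y' : V} (p : Quiver.Path x y) (q : Quiver.Path y y') :
    ρ.path (p.comp q) = ρ.path q * ρ.path p := by
  induction q with
  | nil => exact (ρ.vertex_mul_path p).symm
  | cons q a ih => rw [Quiver.Path.comp_cons, path_cons, path_cons, ih, mul_assoc]

/-- The linear map from the path algebra given by the images of the paths. -/
def liftLinear : PathAlgebra k V →ₗ[k] C :=
  (pathBasis k V).constr k (fun p => ρ.path p.2.2)

theorem liftLinear_ofPath {x y : V} (p : Quiver.Path x y) :
    ρ.liftLinear (ofPath k p) = ρ.path p := by
  rw [liftLinear, ofPath, Module.Basis.constr_basis]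

/-- The algebra homomorphism from the path algebra given by a representation. -/
def lift : PathAlgebra k V →ₐ[k] C :=
  AlgHom.ofLinearMap ρ.liftLinear
    (by
      rw [one_def, map_sum, ← ρ.sum_vertex]
      exact Finset.sum_congr rfl fun x _ => ρ.liftLinear_ofPath _)
    (by
      intro a b
      induction a using path_induction with
      | h0 => simp
      | hadd a a' h h' => rw [add_mul, map_add, map_add, add_mul, h, h']
      | hpath r p =>
        rename_i x y
        rw [smul_mul_assoc, map_smul, map_smul, smul_mul_assoc]
        congr 1
        induction b using path_induction with
        | h0 => simp
        | hadd b b' h h' => rw [mul_add, map_add, map_add, mul_add, h, h']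
        | hpath s q =>
          rename_i x' y'
          rw [mul_smul_comm, map_smul, map_smul, mul_smul_comm]
          congr 1
          rw [liftLinear_ofPath, liftLinear_ofPath]
          by_cases hxy : y' = x
          · subst hxy
            rw [ofPath_mul_ofPath, liftLinear_ofPath, path_comp]
          · rw [ofPath_mul_ofPath_of_ne hxy, map_zero, ← ρ.path_mul_vertex p,
              ← ρ.vertex_mul_path q, mul_assoc, ← mul_assoc (ρ.vertex x),
              ρ.vertex_mul_of_ne _ _ (Ne.symm hxy), zero_mul, mul_zero])

theorem lift_ofPath {x y : V} (p : Quiver.Path x y) : ρ.lift (ofPath k p) = ρ.path p :=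
  ρ.liftLinear_ofPath p

end AlgebraRep

variable (I : TwoSidedIdeal (PathAlgebra k V))

/-- The projection of the path algebra onto a quotient. -/
def quotMk : PathAlgebra k V →ₐ[k] QuotAlg I :=
  { I.ringCon.mk' with commutes' := fun _ => rfl }

theorem quotMk_surjective : Function.Surjective (quotMk I) := I.ringCon.mk'_surjective

theorem quotMk_eq_zero {a : PathAlgebra k V} : quotMk I a = 0 ↔ a ∈ I := by
  change I.ringCon.mk' a = 0 ↔ _
  rw [← TwoSidedIdeal.mem_ker, TwoSidedIdeal.ker_ringCon_mk']

/-- A homomorphism that vanishes on `I` factors through the quotient by `I`. -/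
theorem exists_quotLift (g : PathAlgebra k V →ₐ[k] C) (hg : ∀ a ∈ I, g a = 0) :
    ∃ h : QuotAlg I →ₐ[k] C, ∀ a, h (quotMk I a) = g a := by
  have hle : I.ringCon ≤ RingCon.ker (g : PathAlgebra k V →+* C) := by
    intro a b hab
    rw [RingCon.ker_apply]
    have := hg _ ((TwoSidedIdeal.rel_iff I a b).1 hab)
    rwa [map_sub, sub_eq_zero] at this
  exact ⟨{ I.ringCon.lift (g : PathAlgebra k V →+* C) hle with
    commutes' := fun c => g.commutes c }, fun a => rfl⟩

theorem quotMk_ofVertex (x : V) : quotMk I (ofVertex k x) = idem I x := rfl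

theorem quotMk_ofPath_nil (x : V) :
    quotMk I (ofPath k (Quiver.Path.nil : Quiver.Path x x)) = idem I x := rfl

theorem quotMk_ofPath_cons {x y y' : V} (p : Quiver.Path x y) (a : y ⟶ y') :
    quotMk I (ofPath k (p.cons a)) = arrow I a * quotMk I (ofPath k p) := by
  change _ = quotMk I (ofPath k a.toPath) * _
  rw [← map_mul, ofPath_mul_ofPath]
  rfl

/-- The representation of the quiver in `kQ / I` by the classes of vertices and arrows. -/
def quotRep : AlgebraRep V (QuotAlg I) where
  vertex := idem I
  arrow := arrow I
  vertex_mul_self x := by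
    rw [← quotMk_ofVertex, ← map_mul, ofVertex, ofPath_mul_ofPath, Quiver.Path.comp_nil]
  vertex_mul_of_ne x y hxy := by
    rw [← quotMk_ofVertex, ← quotMk_ofVertex, ← map_mul, ofVertex, ofVertex,
      ofPath_mul_ofPath_of_ne (Ne.symm hxy), map_zero]
  sum_vertex := by
    rw [← map_one (quotMk I), one_def, map_sum]
    rfl
  vertex_mul_arrow {x y} a := by
    change quotMk I (ofVertex k y) * quotMk I (ofPath k a.toPath) = quotMk I (ofPath k a.toPath)
    rw [← map_mul, ofVertex, ofPath_mul_ofPath, Quiver.Path.comp_nil]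
  arrow_mul_vertex {x y} a := by
    change quotMk I (ofPath k a.toPath) * quotMk I (ofVertex k x) = quotMk I (ofPath k a.toPath)
    rw [← map_mul, ofVertex, ofPath_mul_ofPath, Quiver.Path.nil_comp]

theorem quotRep_path {x y : V} (p : Quiver.Path x y) :
    (quotRep I).path p = quotMk I (ofPath k p) := by
  induction p with
  | nil => rfl
  | cons p a ih =>
    rw [AlgebraRep.path_cons, ih, quotMk_ofPath_cons]
    rfl

/-- Linear maps on `kQ / I` are determined by their values on paths. -/
theorem quot_linearMap_ext {M : Type z} [AddCommGroup M] [Module k M] {g h : QuotAlg I →ₗ[k] M}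
    (hp : ∀ {x y : V} (p : Quiver.Path x y),
      g (quotMk I (ofPath k p)) = h (quotMk I (ofPath k p))) : g = h := by
  ext b
  obtain ⟨b, rfl⟩ := quotMk_surjective I b
  induction b using path_induction with
  | h0 => simp
  | hadd a b ha hb => simp only [map_add, ha, hb]
  | hpath c p => simp only [map_smul, hp]

theorem quot_algHom_ext {g h : QuotAlg I →ₐ[k] C} (hv : ∀ x, g (idem I x) = h (idem I x))
    (ha : ∀ {x y : V} (a : x ⟶ y), g (arrow I a) = h (arrow I a)) : g = h := by
  refine AlgHom.toLinearMap_injective (quot_linearMap_ext I fun p => ?_)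
  induction p with
  | nil => exact hv _
  | cons p a ih =>
    simp only [AlgHom.toLinearMap_apply, quotMk_ofPath_cons, map_mul, ha] at ih ⊢
    rw [ih]

theorem eq_top_of_paths_mem (S : Submodule k (QuotAlg I))
    (hS : ∀ {x y : V} (p : Quiver.Path x y), quotMk I (ofPath k p) ∈ S) : S = ⊤ := by
  refine eq_top_iff.2 fun b _ => ?_
  obtain ⟨b, rfl⟩ := quotMk_surjective I b
  induction b using path_induction with
  | h0 => simp
  | hadd a b ha hb => rw [map_add]; exact add_mem (ha trivial) (hb trivial)
  | hpath c p => rw [map_smul]; exact S.smul_mem _ (hS p)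

end Lift

/-! ### Admissible ideals -/

section Admissible

variable {k : Type u} [Field k] {V : Type v} [Quiver.{w} V] [Fintype V]
variable (I : TwoSidedIdeal (PathAlgebra k V))

/-- The subspace of `kQ / I` spanned by the paths of length at least `m`. -/
def longPaths (m : ℕ) : Submodule k (QuotAlg I) :=
  Submodule.span k {b | ∃ (x y : V) (p : Quiver.Path x y), m ≤ p.length ∧ b = quotMk I (ofPath k p)}

variable {I}

theorem quotMk_mem_longPaths {m : ℕ} {x y : V} (p : Quiver.Path x y) (hp : m ≤ p.length) :
    quotMk I (ofPath k p) ∈ longPaths I m :=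
  Submodule.subset_span ⟨x, y, p, hp, rfl⟩

theorem longPaths_mul_le (m n : ℕ) : longPaths I m * longPaths I n ≤ longPaths I (m + n) := by
  rw [longPaths, longPaths, Submodule.span_mul_span, Submodule.span_le]
  rintro _ ⟨_, ⟨x, y, p, hp, rfl⟩, _, ⟨x', y', q, hq, rfl⟩, rfl⟩
  change quotMk I (ofPath k p) * quotMk I (ofPath k q) ∈ longPaths I (m + n)
  rw [← map_mul]
  by_cases h : y' = x
  · subst h
    rw [ofPath_mul_ofPath]
    refine quotMk_mem_longPaths _ ?_
    rw [Quiver.Path.length_comp]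
    omega
  · rw [ofPath_mul_ofPath_of_ne h, map_zero]
    exact zero_mem _

theorem longPaths_zero : longPaths I 0 = ⊤ :=
  eq_top_of_paths_mem I _ fun p => quotMk_mem_longPaths p (Nat.zero_le _)

theorem longPaths_pow_le (m : ℕ) : longPaths I 1 ^ m ≤ longPaths I m := by
  induction m with
  | zero => rw [longPaths_zero]; exact le_top
  | succ m ih =>
    rw [pow_succ]
    exact (Submodule.mul_le.2 fun a ha b hb => Submodule.mul_mem_mul (ih ha) hb).trans
      (longPaths_mul_le m 1)

theorem mul_mem_longPaths {m : ℕ} (b : QuotAlg I) {x : QuotAlg I} (hx : x ∈ longPaths I m) :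
    b * x ∈ longPaths I m := by
  have h := longPaths_mul_le (I := I) 0 m
  rw [zero_add, longPaths_zero] at h
  exact h (Submodule.mul_mem_mul trivial hx)

theorem ofPath_mem_pathIdeal {n : ℕ} {x y : V} (p : Quiver.Path x y) (hp : n ≤ p.length) :
    ofPath k p ∈ pathIdeal k V n := by
  induction p with
  | nil => exact TwoSidedIdeal.subset_span ⟨x, x, .nil, (Nat.le_zero.1 hp).symm, rfl⟩
  | cons p a ih =>
    rcases hp.eq_or_lt with h | h
    · exact TwoSidedIdeal.subset_span ⟨_, _, _, h.symm, rfl⟩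
    · have h1 : ofPath k (p.cons a) = ofPath k a.toPath * ofPath k p :=
        (ofPath_mul_ofPath a.toPath p).symm
      rw [h1]
      exact TwoSidedIdeal.mul_mem_left _ _ _ (ih (Nat.lt_succ_iff.1 h))

theorem longPaths_eq_bot {n : ℕ} (h : pathIdeal k V n ≤ I) : longPaths I n = ⊥ := by
  refine Submodule.span_eq_bot.2 ?_
  rintro _ ⟨x, y, p, hp, rfl⟩
  exact (quotMk_eq_zero I).2 (h (ofPath_mem_pathIdeal p hp))

theorem finite_paths [∀ x y : V, Finite (x ⟶ y)] (m : ℕ) :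
    {b : QuotAlg I | ∃ (x y : V) (p : Quiver.Path x y),
      p.length = m ∧ b = quotMk I (ofPath k p)}.Finite := by
  induction m with
  | zero =>
    refine (Set.finite_range (idem I)).subset ?_
    rintro _ ⟨x, y, p, hp, rfl⟩
    cases p with
    | nil => exact ⟨x, rfl⟩
    | cons p a => simp at hp
  | succ m ih =>
    refine ((Set.finite_range fun a : Σ x y : V, (x ⟶ y) => arrow I a.2.2).mul ih).subset ?_
    rintro _ ⟨x, y, p, hp, rfl⟩
    cases p with
    | nil => simp at hp
    | cons p a =>
      rw [quotMk_ofPath_cons]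
      exact Set.mul_mem_mul ⟨⟨_, _, a⟩, rfl⟩ ⟨_, _, p, by simpa using hp, rfl⟩

/-- A bound quiver algebra is finite dimensional. -/
theorem IsAdmissible.finite [∀ x y : V, Finite (x ⟶ y)] (hI : IsAdmissible I) :
    Module.Finite k (QuotAlg I) := by
  obtain ⟨n, -, hn, -⟩ := hI
  refine ⟨Submodule.fg_def.2 ⟨⋃ m ∈ Finset.range n, {b : QuotAlg I | ∃ (x y : V)
    (p : Quiver.Path x y), p.length = m ∧ b = quotMk I (ofPath k p)},
    Set.Finite.biUnion (Finset.finite_toSet _) fun m _ => finite_paths m, ?_⟩⟩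
  refine eq_top_of_paths_mem I _ fun {x y} p => ?_
  by_cases hp : p.length < n
  · exact Submodule.subset_span (Set.mem_biUnion (Finset.mem_range.2 hp) ⟨x, y, p, rfl, rfl⟩)
  · rw [(quotMk_eq_zero I).2 (hn (ofPath_mem_pathIdeal p (not_lt.1 hp)))]
    exact zero_mem _

open Classical in
/-- The representation of the quiver in `k` by the vertex `x`. -/
def simpleRep (k : Type u) [Field k] (x : V) : AlgebraRep V k where
  vertex y := if y = x then 1 else 0
  arrow _ := 0
  vertex_mul_self y := by split_ifs <;> simp
  vertex_mul_of_ne y z h := by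
    split_ifs with h1 h2
    · exact absurd (h1.trans h2.symm) h
    all_goals simp
  sum_vertex := by simp
  vertex_mul_arrow _ := mul_zero _
  arrow_mul_vertex _ := zero_mul _

theorem simpleRep_path_of_pos (x : V) {y z : V} (p : Quiver.Path y z) (hp : 1 ≤ p.length) :
    (simpleRep k x).path p = 0 := by
  cases p with
  | nil => simp at hp
  | cons p a => exact zero_mul _

/-- The vertices of a bound quiver algebra are vertex idempotents in the abstract sense: the
character of `x` kills `I` because it kills the paths of length two. -/
theorem IsAdmissible.exists_isVertexIdempotent (hI : IsAdmissible I) (x : V) :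
    ∃ χ : QuotAlg I →ₐ[k] k, IsVertexIdempotent (idem I x) (longPaths I 1) χ := by
  obtain ⟨n, -, hn, h2⟩ := hI
  have hker : pathIdeal k V 2 ≤ TwoSidedIdeal.ker ((simpleRep k x).lift (k := k)) := by
    refine TwoSidedIdeal.span_le.2 ?_
    rintro _ ⟨y, z, p, hp, rfl⟩
    rw [SetLike.mem_coe, TwoSidedIdeal.mem_ker, AlgebraRep.lift_ofPath]
    exact simpleRep_path_of_pos x p (by omega)
  obtain ⟨χ, hχ⟩ := exists_quotLift I ((simpleRep k x).lift (k := k))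
    (fun a ha => (TwoSidedIdeal.mem_ker _).1 (hker (h2 ha)))
  have hχp : ∀ {y z : V} (p : Quiver.Path y z),
      χ (quotMk I (ofPath k p)) = (simpleRep k x).path p := fun p => by
    rw [hχ, AlgebraRep.lift_ofPath]
  refine ⟨χ, (quotRep I).vertex_mul_self x, ?_, fun b y hy => mul_mem_longPaths b hy,
    ⟨n, le_bot_iff.1 ((longPaths_pow_le n).trans (longPaths_eq_bot hn).le)⟩, fun b => ?_⟩
  · rw [← quotMk_ofPath_nil, hχp]
    exact if_pos rfl
  · have htop := eq_top_of_paths_mem I ((longPaths I 1).comap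
      (LinearMap.mulRight k (idem I x) - χ.toLinearMap.smulRight (idem I x))) (by
        intro y z p
        change quotMk I (ofPath k p) * idem I x - χ (quotMk I (ofPath k p)) • idem I x ∈
          longPaths I 1
        rw [hχp]
        by_cases hp : 1 ≤ p.length
        · rw [simpleRep_path_of_pos x p hp, zero_smul, sub_zero]
          by_cases hyx : x = y
          · subst hyx
            rw [← quotRep_path, show idem I x = (quotRep I).vertex x from rfl,
              AlgebraRep.path_mul_vertex, quotRep_path]
            exact quotMk_mem_longPaths p hp
          · rw [← quotMk_ofVertex, ← map_mul, ofVertex, ofPath_mul_ofPath_of_ne hyx, map_zero]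
            exact zero_mem _
        · cases p with
          | cons p a => simp at hp
          | nil =>
            rw [quotMk_ofPath_nil, AlgebraRep.path_nil]
            by_cases hyx : y = x
            · subst hyx
              have h1 : (simpleRep k y).vertex y = 1 := if_pos rfl
              have h2 : idem I y * idem I y = idem I y := (quotRep I).vertex_mul_self y
              rw [h1, one_smul, h2, sub_self]
              exact zero_mem _
            · have h1 : (simpleRep k x).vertex y = 0 := if_neg hyx
              have h2 : idem I y * idem I x = 0 := (quotRep I).vertex_mul_of_ne y x hyx
              rw [h1, zero_smul, h2, sub_self]
              exact zero_mem _)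
    exact Submodule.mem_comap.1 (htop ▸ Submodule.mem_top (x := b))

theorem longPaths_le_simpleIdeal (x : V) {b : QuotAlg I} (hb : b ∈ longPaths I 1) :
    b ∈ simpleIdeal I x := by
  have hle : longPaths I 1 ≤ (simpleIdeal I x).restrictScalars k := by
    refine Submodule.span_le.2 ?_
    rintro _ ⟨y, z, p, hp, rfl⟩
    rw [SetLike.mem_coe, Submodule.restrictScalars_mem]
    induction p with
    | nil => simp at hp
    | cons p a ih =>
      rw [quotMk_ofPath_cons]
      cases p with
      | nil =>
        have h1 : arrow I a * quotMk I (ofPath k Quiver.Path.nil) = arrow I a :=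
          (quotRep I).arrow_mul_vertex a
        rw [h1]
        exact Submodule.subset_span (Or.inr ⟨_, _, a, rfl⟩)
      | cons p a' => exact Submodule.smul_mem _ (arrow I a) (ih (by simp))
  exact hle hb

theorem mem_simpleIdeal (x : V) (b : QuotAlg I) :
    b ∈ simpleIdeal I x ↔ b * idem I x ∈ longPaths I 1 := by
  constructor
  · intro hb
    induction hb using Submodule.span_induction with
    | mem b hb =>
      rcases hb with ⟨y, hy, rfl⟩ | ⟨y, z, a, rfl⟩
      · have h2 : idem I y * idem I x = 0 := (quotRep I).vertex_mul_of_ne y x hy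
        rw [h2]
        exact zero_mem _
      · by_cases hyx : x = y
        · subst hyx
          have h1 : arrow I a * idem I x = arrow I a := (quotRep I).arrow_mul_vertex a
          rw [h1]
          exact quotMk_mem_longPaths a.toPath le_rfl
        · change quotMk I (ofPath k a.toPath) * _ ∈ _
          rw [← quotMk_ofVertex, ← map_mul, ofVertex, ofPath_mul_ofPath_of_ne hyx, map_zero]
          exact zero_mem _
    | zero => rw [zero_mul]; exact zero_mem _
    | add b c _ _ hb hc => rw [add_mul]; exact add_mem hb hc
    | smul c b _ hb =>
      rw [smul_eq_mul, mul_assoc]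
      exact mul_mem_longPaths c hb
  · intro hb
    classical
    have h1 : b = b * idem I x + ∑ y ∈ Finset.univ.erase x, b * idem I y := by
      have hs : ∑ y, idem I y = 1 := (quotRep I).sum_vertex
      conv_lhs => rw [← mul_one b, ← hs, Finset.mul_sum]
      exact (Finset.add_sum_erase _ _ (Finset.mem_univ x)).symm
    rw [h1]
    refine add_mem (longPaths_le_simpleIdeal x hb) (sum_mem fun y hy => ?_)
    exact Submodule.smul_mem _ b
      (Submodule.subset_span (Or.inl ⟨y, Finset.ne_of_mem_erase hy, rfl⟩))

end Admissible

/-! ### Adding an arrow to a bound quiver algebra -/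

section AddArrow

variable {k : Type u} [Field k] {V : Type v} [Quiver.{w} V] [Fintype V]
variable {F : Type z} (s t : F → V)

/-- The restriction to `Q` of a representation of the quiver `Q_F`. -/
def AlgebraRep.restrict {C : Type*} [Ring C] (ρ : AlgebraRep (AddArrows s t) C) :
    AlgebraRep V C where
  vertex := ρ.vertex
  arrow a := ρ.arrow ((AddArrows.incl s t).map a)
  vertex_mul_self := ρ.vertex_mul_self
  vertex_mul_of_ne := ρ.vertex_mul_of_ne
  sum_vertex := ρ.sum_vertex
  vertex_mul_arrow a := ρ.vertex_mul_arrow ((AddArrows.incl s t).map a)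
  arrow_mul_vertex a := ρ.arrow_mul_vertex ((AddArrows.incl s t).map a)

variable {s t}

theorem AlgebraRep.path_mapPath {C : Type*} [Ring C] (ρ : AlgebraRep (AddArrows s t) C) {x y : V}
    (p : Quiver.Path x y) :
    ρ.path ((AddArrows.incl s t).mapPath p) = (ρ.restrict s t).path p := by
  induction p with
  | nil => rfl
  | cons p a ih =>
    rw [Prefunctor.mapPath_cons, path_cons, path_cons, ih]
    rfl

theorem AlgebraRep.lift_inclAlg {C : Type*} [Ring C] [Algebra k C]
    (ρ : AlgebraRep (AddArrows s t) C) (b : PathAlgebra k V) :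
    ρ.lift (inclAlg s t b) = (ρ.restrict s t).lift (k := k) b := by
  suffices h : ρ.lift.toLinearMap ∘ₗ inclAlg s t = ((ρ.restrict s t).lift (k := k)).toLinearMap from
    LinearMap.congr_fun h b
  refine (pathBasis k V).ext fun p => ?_
  change ρ.lift (inclAlg s t (pathBasis k V p)) = (ρ.restrict s t).lift (ofPath k p.2.2)
  rw [lift_ofPath, ← ρ.path_mapPath, inclAlg, Module.Basis.constr_basis, lift_ofPath]

variable (s t)

/-- The homomorphism `kQ / I → kQ_F / ⟨I⟩` induced by the inclusion of quivers. -/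
theorem exists_quotIncl (I : TwoSidedIdeal (PathAlgebra k V)) :
    ∃ i : QuotAlg I →ₐ[k] AddArrowsAlg s t I,
      (∀ x, i (idem I x) = idem (V := AddArrows s t) (extIdeal s t I) x) ∧
      ∀ {x y : V} (a : x ⟶ y),
        i (arrow I a) = arrow (extIdeal s t I) ((AddArrows.incl s t).map a) := by
  let ρ := quotRep (extIdeal s t I)
  obtain ⟨i, hi⟩ := exists_quotLift I ((ρ.restrict s t).lift (k := k)) (by
    intro b hb
    rw [← ρ.lift_inclAlg]
    have h1 : ρ.lift.toLinearMap = (quotMk (extIdeal s t I)).toLinearMap := by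
      refine (pathBasis k _).ext fun p => ?_
      change ρ.lift (ofPath k p.2.2) = quotMk _ (ofPath k p.2.2)
      rw [AlgebraRep.lift_ofPath, quotRep_path]
    have h2 : ρ.lift (inclAlg s t b) = quotMk (extIdeal s t I) (inclAlg s t b) :=
      LinearMap.congr_fun h1 _
    rw [h2]
    exact (quotMk_eq_zero _).2 (TwoSidedIdeal.subset_span ⟨b, hb, rfl⟩))
  refine ⟨i, fun x => ?_, fun {x y} a => ?_⟩
  · rw [← quotMk_ofVertex, hi, ofVertex, AlgebraRep.lift_ofPath]
    rfl
  · change i (quotMk I (ofPath k a.toPath)) = _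
    rw [hi, AlgebraRep.lift_ofPath]
    exact ρ.arrow_mul_vertex ((AddArrows.incl s t).map a)

end AddArrow

section OneArrow

variable {k : Type u} [Field k] {V : Type v} [Quiver.{w} V] [Fintype V]

/-- The representation of `Q_{a}` that extends a homomorphism from `kQ / I`, for a chosen image `c`
of the new arrow. -/
def extendRep {I : TwoSidedIdeal (PathAlgebra k V)} {e f : V} {C : Type*} [Ring C] [Algebra k C]
    (g : QuotAlg I →ₐ[k] C) (c : C) (hc : g (idem I f) * c = c) (hc' : c * g (idem I e) = c) :
    AlgebraRep (AddArrows (fun _ : Unit => e) (fun _ : Unit => f)) C where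
  vertex x := g (idem I (show V from x))
  arrow := fun {x y} a => Sum.elim (fun a : (show V from x) ⟶ (show V from y) => g (arrow I a))
    (fun _ => c) a
  vertex_mul_self x := by
    rw [← map_mul]
    exact congrArg g ((quotRep I).vertex_mul_self x)
  vertex_mul_of_ne x y h := by
    rw [← map_mul, ← map_zero g]
    exact congrArg g ((quotRep I).vertex_mul_of_ne x y h)
  sum_vertex := by
    rw [← map_sum, ← map_one g]
    exact congrArg g (quotRep I).sum_vertex
  vertex_mul_arrow {x y} a := by
    rcases a with a | ⟨_, rfl, rfl⟩
    · exact (map_mul g _ _).symm.trans (congrArg g ((quotRep I).vertex_mul_arrow a))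
    · exact hc
  arrow_mul_vertex {x y} a := by
    rcases a with a | ⟨_, rfl, rfl⟩
    · exact (map_mul g _ _).symm.trans (congrArg g ((quotRep I).arrow_mul_vertex a))
    · exact hc'

/-- The algebra `B_{a}` is obtained from `B` by freely adding the class of the arrow `a`. -/
theorem exists_isArrowExtension (I : TwoSidedIdeal (PathAlgebra k V)) (e f : V) :
    ∃ (i : QuotAlg I →ₐ[k] AddArrowsAlg (fun _ : Unit => e) (fun _ : Unit => f) I)
      (a : AddArrowsAlg (fun _ : Unit => e) (fun _ : Unit => f) I),
      IsArrowExtension i (idem I e) (idem I f) a := by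
  let s : Unit → V := fun _ => e
  let t : Unit → V := fun _ => f
  let e' : AddArrows s t := e
  let f' : AddArrows s t := f
  let α : e' ⟶ f' := Sum.inr ⟨(), rfl, rfl⟩
  obtain ⟨i, hiv, hia⟩ := exists_quotIncl s t I
  refine ⟨i, arrow (extIdeal s t I) α, ?_, ?_, ?_⟩
  · rw [hiv, hiv]
    have h1 := (quotRep (extIdeal s t I)).vertex_mul_arrow α
    have h2 := (quotRep (extIdeal s t I)).arrow_mul_vertex α
    exact (congrArg (· * _) h1).trans h2
  · intro C _ _ g c hc
    have he : idem I e * idem I e = idem I e := (quotRep I).vertex_mul_self e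
    have hf : idem I f * idem I f = idem I f := (quotRep I).vertex_mul_self f
    let ρ := extendRep (e := e) (f := f) g c
      (by rw [← hc, ← mul_assoc, ← mul_assoc, ← map_mul, hf])
      (by rw [← hc, mul_assoc, ← map_mul, he])
    have hres : (ρ.restrict s t).lift (k := k) = g.comp (quotMk I) := by
      refine AlgHom.toLinearMap_injective ((pathBasis k V).ext fun p => ?_)
      change (ρ.restrict s t).lift (ofPath k p.2.2) = g (quotMk I (ofPath k p.2.2))
      rw [AlgebraRep.lift_ofPath]
      obtain ⟨x, y, p⟩ := p
      change (ρ.restrict s t).path p = g (quotMk I (ofPath k p))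
      induction p with
      | nil => rfl
      | cons p a ih =>
        rw [AlgebraRep.path_cons, ih, quotMk_ofPath_cons, map_mul]
        rfl
    have hker : extIdeal s t I ≤ TwoSidedIdeal.ker (ρ.lift (k := k)) := by
      refine TwoSidedIdeal.span_le.2 ?_
      rintro _ ⟨b, hb, rfl⟩
      rw [SetLike.mem_coe, TwoSidedIdeal.mem_ker, ρ.lift_inclAlg, hres, AlgHom.comp_apply,
        (quotMk_eq_zero I).2 hb, map_zero]
    obtain ⟨h, hh⟩ := exists_quotLift (extIdeal s t I) (ρ.lift (k := k))
      (fun b hb => (TwoSidedIdeal.mem_ker _).1 (hker hb))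
    have hv : ∀ x : AddArrows s t, h (idem (extIdeal s t I) x) = ρ.vertex x := fun x => by
      rw [← quotMk_ofVertex, hh, ofVertex, AlgebraRep.lift_ofPath, AlgebraRep.path_nil]
    have ha : ∀ {x y : AddArrows s t} (β : x ⟶ y), h (arrow (extIdeal s t I) β) = ρ.arrow β :=
      fun β => (hh _).trans ((ρ.lift_ofPath _).trans (ρ.arrow_mul_vertex β))
    refine ⟨h, quot_algHom_ext I (fun x => ?_) (fun a => ?_), ha α⟩
    · rw [AlgHom.comp_apply, hiv]
      exact hv x
    · rw [AlgHom.comp_apply, hia, ha]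
      rfl
  · intro S h1 hb ha
    refine eq_top_of_paths_mem _ S fun {x y} p => ?_
    induction p with
    | nil =>
      rw [quotMk_ofPath_nil]
      have := hb (idem I (show V from x)) 1 h1
      rwa [hiv, mul_one] at this
    | cons p β ih =>
      rw [quotMk_ofPath_cons]
      rcases β with β | ⟨_, rfl, rfl⟩
      · exact (congrArg (· * _ ∈ S) (hia β)).mp (hb (arrow I β) _ ih)
      · exact ha _ ih

end OneArrow

end QuiverHH

end

theorem corollary4p3 {k : Type u} [Field k] {V : Type v} [Quiver.{w} V] [Fintype V]
    [∀ x y : V, Finite (x ⟶ y)]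
    (I : TwoSidedIdeal (PathAlgebra k V)) (hI : IsAdmissible I)
    (e f : V) (hloop : ¬ IsRelativeLoop I e f)
    (Ie Pf : ModuleCat.{max u v w} (QuotAlg I))
    (ι : SimpleAt I e →ₗ[QuotAlg I] Ie) (hι : IsInjectiveEnvelope ι)
    (π : Pf →ₗ[QuotAlg I] SimpleAt I f) (hπ : IsProjectiveCover π) :
    Module.Finite k (QuotAlg I) ∧
    Module.Finite k (AddArrowsAlg (fun _ : Unit => e) (fun _ : Unit => f) I) ∧
    Module.Finite k (CategoryTheory.Abelian.Ext Ie Pf 1) ∧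
    Module.Finite k (Ie ⟶ Pf) ∧
    (Module.finrank k (HH1 k (AddArrowsAlg (fun _ : Unit => e) (fun _ : Unit => f) I)) : ℤ) -
        Module.finrank k (HH1 k (QuotAlg I)) =
      (Module.finrank k
          (Subalgebra.center k (AddArrowsAlg (fun _ : Unit => e) (fun _ : Unit => f) I)) : ℤ) -
        Module.finrank k (Subalgebra.center k (QuotAlg I)) +
        Module.finrank k (corner I f e) +
        (Module.finrank k (corner I f f) : ℤ) * Module.finrank k (corner I e e) +
        Module.finrank k (CategoryTheory.Abelian.Ext Ie Pf 1) -
        Module.finrank k (Ie ⟶ Pf) := by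
  let : Module k Ie := ModuleCat.moduleOfAlgebraModule Ie
  let : Module k Pf := ModuleCat.moduleOfAlgebraModule Pf
  have : IsScalarTower k (QuotAlg I) Ie := ModuleCat.isScalarTower_of_algebra_moduleCat Ie
  have : IsScalarTower k (QuotAlg I) Pf := ModuleCat.isScalarTower_of_algebra_moduleCat Pf
  have hB : Module.Finite k (QuotAlg I) := hI.finite
  obtain ⟨χ, hχ⟩ := hI.exists_isVertexIdempotent e
  obtain ⟨χ', hχ'⟩ := hI.exists_isVertexIdempotent f
  obtain ⟨i, a, h⟩ := exists_isArrowExtension I e f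
  have he := hχ.idem
  have hf := hχ'.idem
  have hzero : ∀ b, idem I e * b * idem I f = 0 := by
    intro b
    have hbot : corner I e f = ⊥ := not_not.1 hloop
    have hmem : idem I e * (b * idem I f) ∈ corner I e f := ⟨b, rfl⟩
    rw [hbot, Submodule.mem_bot] at hmem
    rw [mul_assoc, hmem]
  have hA := h.finite hzero
  obtain ⟨σ⟩ := hι.nonempty_linearEquiv
    (hχ.isInjectiveEnvelope.{u, max u v w} (J := simpleIdeal I e) (mem_simpleIdeal e))
  obtain ⟨τ⟩ := hπ.nonempty_linearEquiv
    (hχ'.isProjectiveCover (J := simpleIdeal I f) (mem_simpleIdeal f))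
  have hX : Module.Finite k Ie :=
    Module.Finite.of_injective (toLinearForm σ) (toLinearForm_injective σ)
  have hY : Module.Finite k Pf :=
    Module.Finite.of_injective (toAlgebra τ) (toAlgebra_injective τ)
  obtain ⟨hdim, hder⟩ := h.finrank_cocycles1 he hf hzero (homGenerator σ τ)
    (smul_homGenerator_smul hf σ τ) (fun S => eq_top_of_homGenerator_mem σ τ S)
    (finrank_eq_of_equiv_cornerDual he σ) (finrank_eq_of_equiv_leftIdeal τ)
  rw [finrank_lsmul_of_equiv_leftIdeal τ, finrank_lsmul_of_equiv_cornerDual he σ] at hder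
  obtain ⟨hExt, hHom, hdimExt⟩ := finrank_ext_one (k := k) Ie Pf
  refine ⟨hB, hA, hExt, hHom, ?_⟩
  have hHA := finrank_HH1 (k := k)
    (A := AddArrowsAlg (fun _ : Unit => e) (fun _ : Unit => f) I)
  have hHB := finrank_HH1 (k := k) (A := QuotAlg I)
  change _ = _ + _ + (Module.finrank k (corner I f e) +
    Module.finrank k (corner I f f) * Module.finrank k (corner I e e)) at hder
  zify at *
  linarith
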